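/- \textbf{Setting.} Fix one side of the order book. Let $Q$ be the queue at the best quote of that side: a non-explosive birth--death process on $\{0,1,2,\dots\}$ started at $Q(0)\ge 1$, with birth rate $\lambda_k\ge 0$ in state $k\ge 0$ and death rate $\mu_k+\phi_k$ in state $k\ge1$ ($\mu_k,\phi_k\ge 0$; market orders and cancellations). Let $\sigma=\inf\{t\ge 0: Q(t)=0\}$, and assume $\sigma<\infty$ almost surely. No orders are posted inside the spread, so the best quote moves to the next deeper level at time $\tau_{\rm quote}=\sigma$. At the deeper level there are initially $q_0\ge 1$ orders, the last being the order of interest. Let $\tilde W$ be the cancellation-only pure-death process started at $q_0$, independent of $Q$, which jumps from $k$ to $k-1$ at rate $\varphi_k$, where $\varphi_k>0$ for $1\le k\le q_0$. The order of interest is never cancelled, so the number of the initial orders still outstanding at time $t$ is $W(t)=\max(\tilde W(t),1)$. Let $\epsilon_{q_0,m}$ be the first time $\tilde W$ is in state $m$, and put $\hat f(s)=\mathbb E[e^{-s\sigma}]$ and $\hat h_{q_0,m}(s)=\mathbb E[e^{-s\epsilon_{q_0,m}}]$. For a function $H$ and $c>0$, the inverse (two-sided) Laplace transform of $H$ at $t=0$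 along $\operatorname{Re}s=c$ is $\lim_{R\to\infty}\frac1{2\pi i}\int_{c-iR}^{c+iR}H(s)\,ds$. \textbf{Proposition.} (a) For $0\le m\le q_0$, $\epsilon_{q_0,m}<\infty$ almost surely, and for every $s\in\mathbb C$ with $\operatorname{Re}s>-\varphi_k$ for all $m<k\le q_0$, $e^{-s\epsilon_{q_0,m}}$ is integrable and $$\hat h_{q_0,m}(s)=\prod_{k=m+1}^{q_0}\frac{\varphi_k}{\varphi_k+s}.$$ (b) If $q_0\ge 2$, then $\mathbb P[W(\tau_{\rm quote})=q_0]=\mathbb P[\sigma<\epsilon_{q_0,q_0-1}]$, and for every $c\in(0,\varphi_{q_0})$ this is the inverse Laplace transform at $0$, along $\operatorname{Re}s=c$, of $$\frac1s\,\hat f(s)\,\hat h_{q_0,q_0-1}(-s).$$ (c) If $1<m<q_0$, then $\mathbb P[W(\tau_{\rm quote})=m]=\mathbb P[\epsilon_{q_0,m}<\sigma]-\mathbb P[\epsilon_{q_0,m-1}<\sigma]$, and for every $c>0$ with $\mathbb E[e^{c\sigma}]<\infty$ this is the inverse Laplace transform at $0$, along $\operatorname{Re}s=c$, of $$\frac1s\,\hat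 f(-s)\bigl(\hat h_{q_0,m}(s)-\hat h_{q_0,m-1}(s)\bigr).$$ (d) $\mathbb P[W(\tau_{\rm quote})=1]=\mathbb P[\epsilon_{q_0,1}<\sigma]$, and for every $c>0$ with $\mathbb E[e^{c\sigma}]<\infty$ this is the inverse Laplace transform at $0$, along $\operatorname{Re}s=c$, of $$\frac1s\,\hat f(-s)\,\hat h_{q_0,1}(s).$$ -/

import Mathlib

open MeasureTheory ProbabilityTheory Filter Topology
open scoped NNReal ENNReal

noncomputable section

namespace LimitOrderBook

/-- Total jump rate out of state `x` of a birth-death process on the natural numbers with birth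
rates `b` and death rates `d`; no death is possible in state `0`. -/
def totalRate (b d : ℕ → ℝ) (x : ℕ) : ℝ :=
  b x + if x = 0 then 0 else d x

/-- Transition probabilities of the embedded jump chain of a birth-death process. A state with total
rate `0` is absorbing. -/
def jumpProb (b d : ℕ → ℝ) (x y : ℕ) : ℝ :=
  if totalRate b d x = 0 then (if y = x then 1 else 0)
  else if y = x + 1 then b x / totalRate b d x
  else if y + 1 = x then d x / totalRate b d x
  else 0

/-- `X` is a (non-explosive) birth-death process, started at `x₀`, with birth rate `b k` and death
rate `d k` in state `k`, in the jump chain / holding time description of a continuous-time Markov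
chain: `Y` is the embedded jump chain and `T n` the holding time before the `n + 1`-st jump (infinite
in an absorbing state). The chain `Y` starts at `x₀` and moves with probabilities `jumpProb`; given
`Y`, the holding times are independent, and `T n` is exponential with rate `totalRate b d (Y n)`.
The path is `Y n` between the `n`-th and the `n + 1`-st jump times, and these intervals cover all
of `[0, ∞)`. -/
def IsBirthDeath {Ω : Type*} [MeasurableSpace Ω] (P : Measure Ω) (b d : ℕ → ℝ) (x₀ : ℕ)
    (X : ℝ≥0 → Ω → ℕ) : Prop :=
  (∀ t, Measurable (X t)) ∧
  ∃ (Y : ℕ → Ω → ℕ) (T : ℕ → Ω → ℝ≥0∞),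
    (∀ n, Measurable (Y n)) ∧ (∀ n, Measurable (T n)) ∧
    (∀ (n : ℕ) (y : ℕ → ℕ) (t : ℕ → ℝ≥0),
      P {ω | (∀ k ≤ n, Y k ω = y k) ∧ ∀ k < n, (t k : ℝ≥0∞) < T k ω} =
        if y 0 = x₀ then
          ENNReal.ofReal (∏ k ∈ Finset.range n,
            jumpProb b d (y k) (y (k + 1)) * Real.exp (-(totalRate b d (y k) * t k)))
        else 0) ∧
    (∀ᵐ ω ∂P, ∀ t : ℝ≥0, ∃ n : ℕ,
      (∑ k ∈ Finset.range n, T k ω) ≤ t ∧ (t : ℝ≥0∞) < ∑ k ∈ Finset.range (n + 1), T k ω ∧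
      X t ω = Y n ω)

/-- A pure-death process with death rate `d k` in state `k`: no births. -/
def IsPureDeath {Ω : Type*} [MeasurableSpace Ω] (P : Measure Ω) (d : ℕ → ℝ) (x₀ : ℕ)
    (X : ℝ≥0 → Ω → ℕ) : Prop :=
  IsBirthDeath P (fun _ => 0) d x₀ X

/-- First time at which the process `X` is in state `m` (`∞` if this never happens). -/
def firstPassage {Ω : Type*} (X : ℝ≥0 → Ω → ℕ) (m : ℕ) (ω : Ω) : ℝ≥0∞ :=
  ⨅ (t : ℝ≥0) (_ : X t ω = m), (t : ℝ≥0∞)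

/-- Laplace transform `s ↦ E[exp (-s τ)]` of (the law of) a random time `τ`, where the integrand is
`0` on `{τ = ∞}`. If `τ` has a density, this is the Laplace transform of the density. -/
def laplace {Ω : Type*} [MeasurableSpace Ω] (P : Measure Ω) (τ : Ω → ℝ≥0∞) (s : ℂ) : ℂ :=
  ∫ ω in {ω | τ ω ≠ ∞}, Complex.exp (-s * ((τ ω).toReal : ℂ)) ∂P

/-- `v` is the value at `t` of the inverse (two-sided) Laplace transform of `H`, computed along the
line `Re s = c`, that is, the limit as `R → ∞` of the Bromwich integral
`(2 π i)⁻¹ ∫_{c - iR}^{c + iR} exp (s t) H(s) ds`. -/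
def IsInverseLaplaceAt (H : ℂ → ℂ) (c t v : ℝ) : Prop :=
  Tendsto
    (fun R : ℝ => (1 / (2 * Real.pi) : ℂ) *
      ∫ y in (-R)..R, Complex.exp ((c + y * Complex.I) * t) * H (c + y * Complex.I))
    atTop (𝓝 (v : ℂ))

/-- The time at which the best quote first moves to the deeper level: no orders are posted inside
the spread, so this is the first time at which the queue `Q` at the best quote is empty. -/
def quoteTime {Ω : Type*} (Q : ℝ≥0 → Ω → ℕ) : Ω → ℝ≥0∞ :=
  firstPassage Q 0

/-- Number of orders at the deeper level that were present at time `0` and are still outstanding.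
The cancellations follow the pure-death process `Wt`, except that the last of these orders, the one
of interest, is never cancelled. -/
def remaining {Ω : Type*} (Wt : ℝ≥0 → Ω → ℕ) (t : ℝ≥0) (ω : Ω) : ℕ :=
  max (Wt t ω) 1

/-- Probability that exactly `m` of the orders initially at the deeper level are still outstanding
when the best quote moves to that level. -/
def remainingProb {Ω : Type*} [MeasurableSpace Ω] (P : Measure Ω) (Q Wt : ℝ≥0 → Ω → ℕ) (m : ℕ) :
    ℝ :=
  P.real {ω | quoteTime Q ω ≠ ∞ ∧ remaining Wt (quoteTime Q ω).toNNReal ω = m}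

end LimitOrderBook

end

/-! Write σ for the passage time of `Q` to 0 and ε_m for that of `Wt` to m. The process `Wt`
descends one state at a time, so `Wt t ≤ m` is the same event as ε_m ≤ t, and each statement about
the remaining orders becomes a comparison of σ with ε_m and ε_{m-1}. Moreover ε_m is a sum of q - m
independent exponential holding times (`IsPureDeath.exists_holdingTimes`), which gives the product
formula for its transform.

For independent times σ and τ put Z = σ - τ. Then E[exp(sZ)] / s is the product in the Bromwich
integral, and P(τ < σ) = P(Z > 0). By Perron's formula the truncated Bromwich integral of exp(sz)/s
tends to the indicator of z > 0 for z ≠ 0, and Fubini with dominated convergence carries this under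
the expectation (`isInverseLaplaceAt_prob_pos`).

Two facts make this work. The truncated integrals are bounded by a constant times exp(cz), uniformly
in R (`norm_perron_le`), and exp(cZ) is integrable by the exponential moment assumption. Ties σ = τ,
where Perron's limit would be 1/2, are null (`IsPureDeath.ae_firstPassage_ne`): ε_m has no atoms for
m < q, while ε_q = 0 < σ. For m = q the two times exchange roles, and c < φ_q supplies the
exponential moment. -/

namespace LimitOrderBook

/-! ### Perron's formula with a bound uniform in the truncation -/

section Perron

lemma add_mul_I_ne_zero {c : ℝ} (hc : c ≠ 0) (y : ℝ) : (c + y * Complex.I : ℂ) ≠ 0 := by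
  intro h
  apply hc
  simpa using congrArg Complex.re h

lemma abs_le_norm_add_mul_I (c y : ℝ) : |y| ≤ ‖(c + y * Complex.I : ℂ)‖ := by
  simpa using Complex.abs_im_le_norm (c + y * Complex.I : ℂ)

lemma norm_cexp_mul_I_mul (y z : ℝ) : ‖Complex.exp (y * Complex.I * z)‖ = 1 := by
  rw [show (y * Complex.I * z : ℂ) = ((y * z : ℝ) : ℂ) * Complex.I by push_cast; ring]
  exact Complex.norm_exp_ofReal_mul_I _

lemma continuous_cexp_div {c : ℝ} (hc : c ≠ 0) (z : ℝ) (n : ℕ) :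
    Continuous fun y : ℝ => Complex.exp (y * Complex.I * z) / (c + y * Complex.I) ^ n :=
  Continuous.div (by fun_prop) (by fun_prop) fun y => pow_ne_zero _ (add_mul_I_ne_zero hc y)

/-- Integration by parts trades the conditionally convergent 1/s for the absolutely integrable 1/s².
It serves both the uniform bound and the limit. -/
lemma integral_cexp_div_eq {c z : ℝ} (hc : c ≠ 0) (hz : z ≠ 0) (a b : ℝ) :
    ∫ y in a..b, Complex.exp (y * Complex.I * z) / (c + y * Complex.I) =
      Complex.exp (b * Complex.I * z) / (z * Complex.I * (c + b * Complex.I)) -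
        Complex.exp (a * Complex.I * z) / (z * Complex.I * (c + a * Complex.I)) +
      1 / z * ∫ y in a..b, Complex.exp (y * Complex.I * z) / (c + y * Complex.I) ^ 2 := by
  have h1 : IntervalIntegrable
      (fun y : ℝ => Complex.exp (y * Complex.I * z) / (c + y * Complex.I)) volume a b := by
    simpa using (continuous_cexp_div hc z 1).intervalIntegrable a b
  have h2 : IntervalIntegrable
      (fun y : ℝ => 1 / z * (Complex.exp (y * Complex.I * z) / (c + y * Complex.I) ^ 2))
      volume a b := ((continuous_cexp_div hc z 2).intervalIntegrable a b).const_mul _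
  have hd : ∀ y ∈ Set.uIcc a b, HasDerivAt
      (fun y : ℝ => Complex.exp (y * Complex.I * z) / (z * Complex.I * (c + y * Complex.I)))
      (Complex.exp (y * Complex.I * z) / (c + y * Complex.I) -
        1 / z * (Complex.exp (y * Complex.I * z) / (c + y * Complex.I) ^ 2)) y := by
    intro y _
    have hne := add_mul_I_ne_zero hc y
    have hz' : (z : ℂ) ≠ 0 := by exact_mod_cast hz
    have e0 : HasDerivAt (fun y : ℝ => (y : ℂ)) 1 y := Complex.ofRealCLM.hasDerivAt
    have e1 := ((e0.mul_const Complex.I).mul_const (z : ℂ)).cexp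
    have e2 := ((e0.mul_const Complex.I).const_add (c : ℂ)).const_mul (z * Complex.I)
    refine (e1.div e2 (mul_ne_zero (mul_ne_zero hz' Complex.I_ne_zero) hne)).congr_deriv ?_
    field_simp
  have := intervalIntegral.integral_eq_sub_of_hasDerivAt hd (h1.sub h2)
  rw [intervalIntegral.integral_sub h1 h2, intervalIntegral.integral_const_mul] at this
  rw [← this]
  ring

/-- Beyond 1/|z|, integration by parts leaves two boundary terms of norm at most 1 and an integral
of norm at most |z| with prefactor 1/|z|: 3 in all. The sign of c is left free so that the left tail
can be reflected onto this case. -/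
lemma norm_integral_cexp_div_tail_le {c z : ℝ} (hc : c ≠ 0) (hz : z ≠ 0) {R : ℝ}
    (hR : |z|⁻¹ ≤ R) :
    ‖∫ y in |z|⁻¹..R, Complex.exp (y * Complex.I * z) / (c + y * Complex.I)‖ ≤ 3 := by
  have hz0 : 0 < |z| := abs_pos.2 hz
  have ha : 0 < |z|⁻¹ := inv_pos.2 hz0
  have hbd : ∀ b : ℝ, |z|⁻¹ ≤ b →
      ‖Complex.exp (b * Complex.I * z) / (z * Complex.I * (c + b * Complex.I))‖ ≤ 1 := by
    intro b hb
    have hb1 := abs_le_norm_add_mul_I c b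
    rw [norm_div, norm_cexp_mul_I_mul, norm_mul, norm_mul, Complex.norm_I, Complex.norm_real,
      Real.norm_eq_abs, mul_one]
    apply div_le_one_of_le₀ _ (by positivity)
    calc (1 : ℝ) = |z| * |z|⁻¹ := by field_simp
      _ ≤ |z| * ‖(c + b * Complex.I : ℂ)‖ := by
        gcongr; exact (hb.trans (le_abs_self b)).trans hb1
  have hint : ‖∫ y in |z|⁻¹..R, Complex.exp (y * Complex.I * z) / (c + y * Complex.I) ^ 2‖ ≤
      |z| := by
    have hinv : ∀ y ∈ Set.uIcc |z|⁻¹ R, y ≠ 0 := fun y hy =>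
      (ha.trans_le ((Set.uIcc_of_le hR ▸ hy : y ∈ Set.Icc _ _).1)).ne'
    have hii : IntervalIntegrable (fun y : ℝ => (y ^ 2)⁻¹) volume |z|⁻¹ R :=
      ContinuousOn.intervalIntegrable
        (ContinuousOn.inv₀ (by fun_prop) fun y hy => pow_ne_zero _ (hinv y hy))
    calc _ ≤ ∫ y in |z|⁻¹..R, (y ^ 2)⁻¹ := by
          apply intervalIntegral.norm_integral_le_of_norm_le hR _ hii
          refine ae_of_all _ fun y hy => ?_
          have hy0 : 0 < y := ha.trans hy.1
          rw [norm_div, norm_cexp_mul_I_mul, norm_pow, one_div]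
          gcongr
          exact (le_abs_self y).trans (abs_le_norm_add_mul_I c y)
      _ = -R⁻¹ - -(|z|⁻¹)⁻¹ := by
          apply intervalIntegral.integral_eq_sub_of_hasDerivAt (f := fun y => -y⁻¹) _ hii
          intro y hy
          simpa [Function.comp_def, Pi.neg_def] using (hasDerivAt_inv (hinv y hy)).neg
      _ ≤ |z| := by
          have : 0 < R := ha.trans_le hR
          have := inv_pos.2 this
          rw [inv_inv]; linarith
  rw [integral_cexp_div_eq hc hz]
  refine (norm_add_le _ _).trans ?_
  have h1 := (norm_sub_le _ _).trans (add_le_add (hbd R hR) (hbd _ le_rfl))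
  have h2 : ‖(1 / z : ℂ) * ∫ y in |z|⁻¹..R,
      Complex.exp (y * Complex.I * z) / (c + y * Complex.I) ^ 2‖ ≤ 1 := by
    rw [norm_mul, norm_div, norm_one, Complex.norm_real, Real.norm_eq_abs]
    calc _ ≤ 1 / |z| * |z| := by gcongr
      _ = 1 := by field_simp
  linarith

/-- The antiderivative is log(c + iy)/i. Its endpoints are conjugate, so the difference of
logarithms is 2i times one argument. -/
lemma norm_integral_one_div_add_mul_I_le {c : ℝ} (hc : 0 < c) (a : ℝ) :
    ‖∫ y in (-a)..a, 1 / (c + y * Complex.I : ℂ)‖ ≤ 2 * Real.pi := by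
  have hs : ∀ y : ℝ, (c + y * Complex.I : ℂ) ∈ Complex.slitPlane := fun y =>
    Or.inl (by simpa using hc)
  have hd : ∀ y ∈ Set.uIcc (-a) a, HasDerivAt
      (fun y : ℝ => Complex.log (c + y * Complex.I) / Complex.I) (1 / (c + y * Complex.I : ℂ)) y := by
    intro y _
    have e0 : HasDerivAt (fun y : ℝ => (y : ℂ)) 1 y := Complex.ofRealCLM.hasDerivAt
    refine ((((e0.mul_const Complex.I).const_add (c : ℂ)).clog_real (hs y)).div_const
      Complex.I).congr_deriv ?_
    have := add_mul_I_ne_zero hc.ne' y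
    field_simp
  have hi : IntervalIntegrable (fun y : ℝ => 1 / (c + y * Complex.I : ℂ)) volume (-a) a := by
    simpa using (continuous_cexp_div hc.ne' 0 1).intervalIntegrable (-a) a
  rw [intervalIntegral.integral_eq_sub_of_hasDerivAt hd hi, ← sub_div, norm_div, Complex.norm_I,
    div_one]
  have hconj : (c + (-a : ℝ) * Complex.I : ℂ) = (starRingEnd ℂ) (c + a * Complex.I) := by
    simp
  have harg : Complex.arg (c + a * Complex.I) ≠ Real.pi := Complex.slitPlane_arg_ne_pi (hs a)
  rw [hconj, Complex.log_conj _ harg, Complex.sub_conj, norm_mul, Complex.norm_I, mul_one,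
    Complex.norm_real, Real.norm_eq_abs, Complex.log_im, abs_mul, abs_two]
  have := Complex.abs_arg_le_pi (c + a * Complex.I)
  linarith

/-- Since |exp(iyz) - 1| ≤ |y||z| and |c + iy| ≥ |y|, replacing the exponential by 1 costs at most
2a|z| ≤ 2. -/
lemma norm_integral_cexp_div_center_le {c : ℝ} (hc : 0 < c) {z a : ℝ} (ha : 0 ≤ a)
    (haz : a * |z| ≤ 1) :
    ‖∫ y in (-a)..a, Complex.exp (y * Complex.I * z) / (c + y * Complex.I)‖ ≤
      2 + 2 * Real.pi := by
  have h1 : IntervalIntegrable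
      (fun y : ℝ => Complex.exp (y * Complex.I * z) / (c + y * Complex.I)) volume (-a) a := by
    simpa using (continuous_cexp_div hc.ne' z 1).intervalIntegrable (-a) a
  have h2 : IntervalIntegrable (fun y : ℝ => 1 / (c + y * Complex.I : ℂ)) volume (-a) a := by
    simpa using (continuous_cexp_div hc.ne' 0 1).intervalIntegrable (-a) a
  have h3 : ‖∫ y in (-a)..a, (Complex.exp (y * Complex.I * z) / (c + y * Complex.I) -
      1 / (c + y * Complex.I : ℂ))‖ ≤ |z| * |a - -a| := by
    apply intervalIntegral.norm_integral_le_of_norm_le_const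
    intro y _
    rw [← sub_div, norm_div]
    have hn : 0 < ‖(c + y * Complex.I : ℂ)‖ := norm_pos_iff.2 (add_mul_I_ne_zero hc.ne' y)
    rw [div_le_iff₀ hn]
    have : ‖Complex.exp (Complex.I * ((y * z : ℝ) : ℂ)) - 1‖ ≤ ‖y * z‖ :=
      Real.norm_exp_I_mul_ofReal_sub_one_le
    rw [show (Complex.I * ((y * z : ℝ) : ℂ)) = y * Complex.I * z by push_cast; ring,
      Real.norm_eq_abs, abs_mul, mul_comm |y|] at this
    exact this.trans (mul_le_mul_of_nonneg_left (abs_le_norm_add_mul_I c y) (abs_nonneg z))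
  rw [intervalIntegral.integral_sub h1 h2] at h3
  have h4 : |z| * |a - -a| ≤ 2 := by
    rw [sub_neg_eq_add, abs_of_nonneg (by linarith : 0 ≤ a + a)]; linarith
  calc _ = ‖((∫ y in (-a)..a, Complex.exp (y * Complex.I * z) / (c + y * Complex.I)) -
        ∫ y in (-a)..a, 1 / (c + y * Complex.I : ℂ)) +
        ∫ y in (-a)..a, 1 / (c + y * Complex.I : ℂ)‖ := by rw [sub_add_cancel]
    _ ≤ _ := (norm_add_le _ _).trans
        (add_le_add (h3.trans h4) (norm_integral_one_div_add_mul_I_le hc a))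

/-- Cut at |y| = 1/|z|, where oscillation starts to help: 3 + (2 + 2π) + 3. -/
lemma norm_integral_cexp_div_le {c : ℝ} (hc : 0 < c) (z : ℝ) {R : ℝ} (hR : 0 ≤ R) :
    ‖∫ y in (-R)..R, Complex.exp (y * Complex.I * z) / (c + y * Complex.I)‖ ≤
      8 + 2 * Real.pi := by
  by_cases h : R * |z| ≤ 1
  · exact (norm_integral_cexp_div_center_le hc hR h).trans (by linarith)
  have hz : z ≠ 0 := by rintro rfl; simp at h
  have hz0 : 0 < |z| := abs_pos.2 hz
  have haR : |z|⁻¹ ≤ R := by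
    rw [inv_le_iff_one_le_mul₀ hz0]; linarith
  have hi : ∀ a b : ℝ, IntervalIntegrable
      (fun y : ℝ => Complex.exp (y * Complex.I * z) / (c + y * Complex.I)) volume a b := by
    intro a b
    simpa using (continuous_cexp_div hc.ne' z 1).intervalIntegrable a b
  -- The substitution y ↦ -y turns the left tail for (c, z) into minus the right tail for (-c, -z).
  have hneg : ‖∫ y in (-R)..(-|z|⁻¹), Complex.exp (y * Complex.I * z) / (c + y * Complex.I)‖
      ≤ 3 := by
    have h1 := norm_integral_cexp_div_tail_le (neg_ne_zero.2 hc.ne') (neg_ne_zero.2 hz)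
      (R := R) (by rwa [abs_neg])
    rw [abs_neg] at h1
    rw [← intervalIntegral.integral_comp_neg, ← norm_neg, ← intervalIntegral.integral_neg]
    refine le_of_eq_of_le (congrArg _ ?_) h1
    refine intervalIntegral.integral_congr fun y _ => ?_
    rw [← div_neg]
    congr 2
    · push_cast; ring
    · push_cast; ring
  have hpos := norm_integral_cexp_div_tail_le hc.ne' hz haR
  have hcen := norm_integral_cexp_div_center_le hc (z := z) (inv_nonneg.2 hz0.le)
    (inv_mul_cancel₀ hz0.ne').le
  rw [← intervalIntegral.integral_add_adjacent_intervals (hi (-R) (-|z|⁻¹)) (hi _ R),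
    ← intervalIntegral.integral_add_adjacent_intervals (hi (-|z|⁻¹) (|z|⁻¹)) (hi _ R)]
  refine (norm_add_le _ _).trans ((add_le_add hneg ((norm_add_le _ _).trans
    (add_le_add hcen hpos))).trans (by linarith))

lemma integral_mul_cexp_neg_Ioi {s : ℂ} (hs : 0 < s.re) :
    ∫ t in Set.Ioi (0 : ℝ), (t : ℂ) * Complex.exp (-(s * t)) = 1 / s ^ 2 := by
  have hs0 : s ≠ 0 := by rintro rfl; simp at hs
  have hnorm : ∀ t : ℝ, ‖Complex.exp (-(s * t))‖ = Real.exp (-s.re * t) := by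
    intro t; rw [Complex.norm_exp]; simp
  have hd : ∀ t ∈ Set.Ici (0 : ℝ), HasDerivAt
      (fun t : ℝ => -((t / s + 1 / s ^ 2) * Complex.exp (-(s * t))))
      ((t : ℂ) * Complex.exp (-(s * t))) t := by
    intro t _
    have e0 : HasDerivAt (fun t : ℝ => (t : ℂ)) 1 t := Complex.ofRealCLM.hasDerivAt
    refine (((e0.div_const s).add_const (1 / s ^ 2)).mul
      ((e0.const_mul s).neg.cexp)).neg.congr_deriv ?_
    simp only [Pi.neg_apply]
    field_simp
    ring
  have hint : IntegrableOn (fun t : ℝ => (t : ℂ) * Complex.exp (-(s * t))) (Set.Ioi 0) := by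
    have h := integrableOn_rpow_mul_exp_neg_mul_rpow (s := 1) (p := 1) (by norm_num) one_pos hs
    refine Integrable.mono' h (by fun_prop) ?_
    filter_upwards [ae_restrict_mem measurableSet_Ioi] with t ht
    rw [norm_mul, hnorm, Complex.norm_real, Real.norm_of_nonneg (le_of_lt ht), Real.rpow_one]
  have hlim : Tendsto (fun t : ℝ => -((t / s + 1 / s ^ 2) * Complex.exp (-(s * t)))) atTop
      (𝓝 0) := by
    have h1 := tendsto_rpow_mul_exp_neg_mul_atTop_nhds_zero 1 s.re hs
    have h0 := tendsto_rpow_mul_exp_neg_mul_atTop_nhds_zero 0 s.re hs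
    have h2 := (h1.mul_const ‖1 / s‖).add (h0.mul_const ‖1 / s ^ 2‖)
    simp only [zero_mul, add_zero] at h2
    refine squeeze_zero_norm' ?_ h2
    filter_upwards [eventually_ge_atTop 0] with t ht
    rw [norm_neg, norm_mul, hnorm, Real.rpow_one, Real.rpow_zero]
    calc _ ≤ (‖(t / s : ℂ)‖ + ‖1 / s ^ 2‖) * Real.exp (-s.re * t) := by
          gcongr; exact norm_add_le _ _
      _ = _ := by
          rw [norm_div, norm_div, norm_div, norm_one, Complex.norm_real, Real.norm_of_nonneg ht]
          ring
  rw [integral_Ioi_of_hasDerivAt_of_tendsto' hd hint hlim]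
  simp

lemma integrable_cexp_div_sq {c : ℝ} (hc : 0 < c) (z : ℝ) :
    Integrable fun y : ℝ => Complex.exp (y * Complex.I * z) / (c + y * Complex.I) ^ 2 := by
  have h := (integrable_inv_one_add_sq.comp_mul_right' (inv_ne_zero hc.ne')).const_mul (c ^ 2)⁻¹
  refine Integrable.mono' h (continuous_cexp_div hc.ne' z 2).aestronglyMeasurable
    (ae_of_all _ fun y => le_of_eq ?_)
  rw [norm_div, norm_cexp_mul_I_mul, norm_pow, Complex.sq_norm, Complex.normSq_add_mul_I]
  field_simp

/-- Fourier inversion for t exp(-ct) on t > 0. This function is continuous and integrable with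
integrable transform, whereas the original of 1/s jumps at 0; hence the detour through 1/s². -/
lemma integral_cexp_div_sq {c : ℝ} (hc : 0 < c) (z : ℝ) :
    ∫ y : ℝ, Complex.exp (y * Complex.I * z) / (c + y * Complex.I) ^ 2 =
      2 * Real.pi * ((max z 0 * Real.exp (-(c * z)) : ℝ) : ℂ) := by
  set f : ℝ → ℂ := fun t => ((max t 0 * Real.exp (-(c * t)) : ℝ) : ℂ) with hf
  have hpi := Real.pi_pos
  have hfc : Continuous f := by fun_prop
  have hsupp : ∀ t : ℝ, t ∉ Set.Ioi (0 : ℝ) → f t = 0 := by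
    intro t ht
    simp [hf, max_eq_right (not_lt.1 ht : t ≤ 0)]
  have hfi : Integrable f := by
    rw [← integrableOn_iff_integrable_of_support_subset (s := Set.Ioi 0)
      (fun t ht => by_contra fun h => ht (hsupp t h))]
    have h := integrableOn_rpow_mul_exp_neg_mul_rpow (s := 1) (p := 1) (by norm_num) one_pos hc
    refine Integrable.mono' h (by fun_prop) ?_
    filter_upwards [ae_restrict_mem measurableSet_Ioi] with t ht
    have ht' : (0 : ℝ) < t := ht
    rw [hf, Complex.norm_real, Real.norm_of_nonneg (by positivity), max_eq_left ht'.le,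
      Real.rpow_one, neg_mul]
  have hF : FourierTransform.fourier f =
      fun w : ℝ => 1 / (c + (2 * Real.pi * w : ℝ) * Complex.I : ℂ) ^ 2 := by
    ext w
    rw [Real.fourier_real_eq_integral_exp_smul, ← setIntegral_eq_integral_of_forall_compl_eq_zero
      (s := Set.Ioi 0) (fun t ht => by rw [hsupp t ht, smul_zero]),
      ← integral_mul_cexp_neg_Ioi (by simpa using hc)]
    refine setIntegral_congr_fun measurableSet_Ioi fun t ht => ?_
    have ht' : (0 : ℝ) < t := ht
    simp only [hf, max_eq_left ht'.le, smul_eq_mul]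
    push_cast
    rw [mul_left_comm, ← Complex.exp_add]
    ring_nf
  have hFi : Integrable (FourierTransform.fourier f) := by
    rw [hF]
    simpa using (integrable_cexp_div_sq hc 0).comp_mul_left' (mul_pos two_pos hpi).ne'
  have hinv := hfi.fourierInv_fourier_eq hFi (v := z) hfc.continuousAt
  rw [Real.fourierInv_eq', hF] at hinv
  have hsub := Measure.integral_comp_mul_left
    (fun y : ℝ => Complex.exp (y * Complex.I * z) / (c + y * Complex.I) ^ 2) (2 * Real.pi)
  have h2 : f z = (2 * Real.pi)⁻¹ *
      ∫ y : ℝ, Complex.exp (y * Complex.I * z) / (c + y * Complex.I) ^ 2 := by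
    rw [← hinv]
    rw [abs_of_pos (by positivity), Complex.real_smul] at hsub
    push_cast at hsub ⊢
    rw [← hsub]
    refine integral_congr_ae (ae_of_all _ fun v => ?_)
    simp only [smul_eq_mul, mul_one_div]
    congr 2
    simp
    ring
  have hpi' : (Real.pi : ℂ) ≠ 0 := by exact_mod_cast hpi.ne'
  rw [show ((max z 0 * Real.exp (-(c * z)) : ℝ) : ℂ) = f z from rfl, h2]
  push_cast
  rw [mul_inv_cancel_left₀ (mul_ne_zero two_ne_zero hpi')]

/-- Perron's formula: the truncated Bromwich integral of `exp (s z) / s`. -/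
noncomputable def perron (c R z : ℝ) : ℂ :=
  1 / (2 * Real.pi) * ∫ y in (-R)..R,
    Complex.exp ((c + y * Complex.I) * z) / (c + y * Complex.I)

lemma perron_eq (c R z : ℝ) :
    perron c R z = 1 / (2 * Real.pi) * (Complex.exp (c * z) * ∫ y in (-R)..R,
      Complex.exp (y * Complex.I * z) / (c + y * Complex.I)) := by
  rw [perron, ← intervalIntegral.integral_const_mul (Complex.exp (c * z))]
  congr 1
  apply intervalIntegral.integral_congr
  intro y _
  simp only []
  rw [add_mul, Complex.exp_add, mul_div_assoc]

lemma norm_perron_le {c : ℝ} (hc : 0 < c) {R : ℝ} (hR : 0 ≤ R) (z : ℝ) :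
    ‖perron c R z‖ ≤ (8 + 2 * Real.pi) * Real.exp (c * z) := by
  have hpi := Real.two_le_pi
  rw [perron_eq, norm_mul, norm_mul, ← Complex.ofReal_mul, Complex.norm_exp_ofReal]
  have h1 : ‖(1 / (2 * Real.pi) : ℂ)‖ ≤ 1 := by
    rw [show (1 / (2 * Real.pi) : ℂ) = ((1 / (2 * Real.pi) : ℝ) : ℂ) by push_cast; ring,
      Complex.norm_real, Real.norm_of_nonneg (by positivity), div_le_one (by positivity)]
    linarith
  calc _ ≤ 1 * (Real.exp (c * z) * (8 + 2 * Real.pi)) := by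
        gcongr; exact norm_integral_cexp_div_le hc z hR
    _ = _ := by ring

lemma tendsto_cexp_div_mul_zero {c z : ℝ} (hz : z ≠ 0) (g : ℝ → ℝ)
    (hg : Tendsto (fun R => |g R|) atTop atTop) :
    Tendsto (fun R : ℝ => Complex.exp (g R * Complex.I * z) /
      (z * Complex.I * (c + g R * Complex.I))) atTop (𝓝 0) := by
  have hz0 : 0 < |z| := abs_pos.2 hz
  refine squeeze_zero_norm' ?_ (hg.const_mul_atTop hz0).inv_tendsto_atTop
  filter_upwards [hg.eventually_gt_atTop 0] with R hR
  rw [norm_div, norm_cexp_mul_I_mul, norm_mul, norm_mul, Complex.norm_I, Complex.norm_real,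
      Real.norm_eq_abs, mul_one, one_div, Pi.inv_apply]
  gcongr
  exact abs_le_norm_add_mul_I c _

/-- After integration by parts the boundary terms vanish, and the 1/s² integral leaves (1/z) max(z,
0), the indicator of z > 0. -/
lemma tendsto_perron {c : ℝ} (hc : 0 < c) {z : ℝ} (hz : z ≠ 0) :
    Tendsto (fun R => perron c R z) atTop (𝓝 (if 0 < z then 1 else 0)) := by
  have hlim : Tendsto (fun R : ℝ => ∫ y in (-R)..R,
      Complex.exp (y * Complex.I * z) / (c + y * Complex.I) ^ 2) atTop
      (𝓝 (2 * Real.pi * ((max z 0 * Real.exp (-(c * z)) : ℝ) : ℂ))) := by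
    rw [← integral_cexp_div_sq hc z]
    exact intervalIntegral_tendsto_integral (integrable_cexp_div_sq hc z)
      tendsto_neg_atTop_atBot tendsto_id
  have hb1 := tendsto_cexp_div_mul_zero (c := c) hz (fun R => R) tendsto_abs_atTop_atTop
  have hb2 := tendsto_cexp_div_mul_zero (c := c) hz (fun R => -R)
    (by simpa using tendsto_abs_atTop_atTop)
  have hall := (((hb1.sub hb2).add (hlim.const_mul (1 / z : ℂ))).const_mul
    (Complex.exp (c * z))).const_mul (1 / (2 * Real.pi) : ℂ)
  convert hall using 1
  · ext R
    rw [perron_eq, integral_cexp_div_eq hc.ne' hz]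
  · congr 1
    have hz' : (z : ℂ) ≠ 0 := by exact_mod_cast hz
    have hpi' : (Real.pi : ℂ) ≠ 0 := by exact_mod_cast Real.pi_ne_zero
    split_ifs with h
    · rw [max_eq_left h.le]
      push_cast
      have : Complex.exp (c * z) * Complex.exp (-(c * z)) = 1 := by
        rw [← Complex.exp_add, add_neg_cancel, Complex.exp_zero]
      field_simp
      linear_combination (-2 * Real.pi : ℂ) * this
    · rw [max_eq_right (not_lt.1 h)]
      simp

variable {Ω : Type*} [MeasurableSpace Ω] {P : Measure Ω}

lemma integrable_uncurry_cexp_div [SFinite P] {Z : Ω → ℝ} (hZ : AEMeasurable Z P) {c : ℝ} (hc : 0 < c)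
    (hint : Integrable (fun ω => Real.exp (c * Z ω)) P) (a b : ℝ) :
    Integrable (Function.uncurry fun (y : ℝ) ω =>
        Complex.exp ((c + y * Complex.I) * Z ω) / (c + y * Complex.I))
      ((volume.restrict (Set.uIoc a b)).prod P) := by
  have : IsFiniteMeasure ((volume : Measure ℝ).restrict (Set.uIoc a b)) :=
    ⟨by simp [Set.uIoc]⟩
  have hdom : Integrable (fun p : ℝ × Ω => 1 / c * Real.exp (c * Z p.2))
      ((volume.restrict (Set.uIoc a b)).prod P) :=
    Integrable.mul_prod (f := fun _ : ℝ => 1 / c) (integrable_const _) hint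
  refine hdom.mono' ?_ (ae_of_all _ fun p => ?_)
  · have h1 : AEMeasurable (fun p : ℝ × Ω => Z p.2)
        ((volume.restrict (Set.uIoc a b)).prod P) := hZ.comp_snd
    simp only [Function.uncurry_def]
    exact AEMeasurable.aestronglyMeasurable (by fun_prop)
  · simp only [Function.uncurry_def]
    rw [norm_div, div_eq_inv_mul, one_div, Complex.norm_exp]
    gcongr
    · simpa [abs_of_pos hc] using Complex.abs_re_le_norm (c + p.1 * Complex.I : ℂ)
    · simp

lemma intervalIntegrable_one_div_mul_integral_cexp [IsProbabilityMeasure P] {Z : Ω → ℝ} (hZ : AEMeasurable Z P) {c : ℝ}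
    (hc : 0 < c) (hint : Integrable (fun ω => Real.exp (c * Z ω)) P) (a b : ℝ) :
    IntervalIntegrable (fun y : ℝ => 1 / (c + y * Complex.I) *
      ∫ ω, Complex.exp ((c + y * Complex.I) * Z ω) ∂P) volume a b := by
  rw [intervalIntegrable_iff]
  refine (integrable_uncurry_cexp_div hZ hc hint a b).integral_prod_left.congr
    (ae_of_all _ fun y => ?_)
  simp only [Function.uncurry_def]
  rw [integral_div]
  ring

lemma isInverseLaplaceAt_prob_pos [IsProbabilityMeasure P] {Z : Ω → ℝ} (hZ : AEMeasurable Z P) (hZ0 : ∀ᵐ ω ∂P, Z ω ≠ 0)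
    {c : ℝ} (hc : 0 < c) (hint : Integrable (fun ω => Real.exp (c * Z ω)) P) {H : ℂ → ℂ}
    (hH : ∀ s : ℂ, s.re = c → H s = 1 / s * ∫ ω, Complex.exp (s * Z ω) ∂P) :
    IsInverseLaplaceAt H c 0 (P.real {ω | 0 < Z ω}) := by
  have hmeas : NullMeasurableSet {ω | 0 < Z ω} P := nullMeasurableSet_lt (by fun_prop) hZ
  have key : ∀ R : ℝ, (1 / (2 * Real.pi) : ℂ) * ∫ y in (-R)..R,
      Complex.exp ((c + y * Complex.I) * (0 : ℝ)) * H (c + y * Complex.I) =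
      ∫ ω, perron c R (Z ω) ∂P := by
    intro R
    simp only [perron]
    rw [integral_const_mul, ← intervalIntegral_integral_swap]
    · congr 2
      ext y
      rw [hH _ (by simp), ← integral_const_mul]
      simp only [Complex.ofReal_zero, mul_zero, Complex.exp_zero, one_mul]
      refine integral_congr_ae (ae_of_all _ fun ω => ?_)
      simp only []
      ring
    · exact integrable_uncurry_cexp_div hZ hc hint _ _
  have hval : ((P.real {ω | 0 < Z ω} : ℝ) : ℂ) = ∫ ω, (if 0 < Z ω then (1 : ℂ) else 0) ∂P := by
    have : (fun ω => if 0 < Z ω then (1 : ℂ) else 0) = {ω | 0 < Z ω}.indicator fun _ => 1 := by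
      ext ω; simp [Set.indicator_apply]
    rw [this, integral_indicator₀ hmeas]
    simp
  unfold IsInverseLaplaceAt
  simp_rw [key]
  rw [hval]
  refine tendsto_integral_filter_of_dominated_convergence
    (fun ω => (8 + 2 * Real.pi) * Real.exp (c * Z ω)) ?_ ?_ (hint.const_mul _) ?_
  · refine Eventually.of_forall fun R => ?_
    have h1 : Measurable (fun z : ℝ => perron c R z) := by
      apply Measurable.const_mul
      have : StronglyMeasurable (Function.uncurry fun (z y : ℝ) =>
          Complex.exp ((c + y * Complex.I) * z) / (c + y * Complex.I)) :=
        Measurable.stronglyMeasurable (by simp only [Function.uncurry_def]; fun_prop)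
      simp only [intervalIntegral]
      exact (this.integral_prod_right.sub this.integral_prod_right).measurable
    exact (h1.comp_aemeasurable hZ).aestronglyMeasurable
  · filter_upwards [eventually_ge_atTop 0] with R hR
    exact ae_of_all _ fun ω => norm_perron_le hc hR _
  · filter_upwards [hZ0] with ω hω
    exact tendsto_perron hc hω

/-- Independence merges the two transforms into that of A - B, and B ≥ 0 gives exp(c(A - B)) ≤
exp(cA). Interval integrability is carried along because `IsInverseLaplaceAt.sub` needs it. -/
lemma isInverseLaplaceAt_prob_lt [IsProbabilityMeasure P] {A B : Ω → ℝ} (hA : AEMeasurable A P) (hB : AEMeasurable B P)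
    (hAB : IndepFun A B P) (hne : ∀ᵐ ω ∂P, A ω ≠ B ω) (hB0 : ∀ ω, 0 ≤ B ω)
    {c : ℝ} (hc : 0 < c) (hint : Integrable (fun ω => Real.exp (c * A ω)) P) :
    (∀ R : ℝ, IntervalIntegrable (fun y : ℝ => 1 / (c + y * Complex.I) *
      (∫ ω, Complex.exp ((c + y * Complex.I) * A ω) ∂P) *
      ∫ ω, Complex.exp (-(c + y * Complex.I) * B ω) ∂P) volume (-R) R) ∧
    IsInverseLaplaceAt (fun s => 1 / s * (∫ ω, Complex.exp (s * A ω) ∂P) *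
      ∫ ω, Complex.exp (-s * B ω) ∂P) c 0 (P.real {ω | B ω < A ω}) := by
  have hZ : AEMeasurable (fun ω => A ω - B ω) P := hA.sub hB
  have hZint : Integrable (fun ω => Real.exp (c * (A ω - B ω))) P := by
    refine hint.mono' (AEMeasurable.aestronglyMeasurable (by fun_prop)) (ae_of_all _ fun ω => ?_)
    rw [Real.norm_of_nonneg (Real.exp_pos _).le]
    gcongr
    linarith [hB0 ω]
  have hprod : ∀ s : ℂ, 1 / s * (∫ ω, Complex.exp (s * A ω) ∂P) *
      ∫ ω, Complex.exp (-s * B ω) ∂P =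
      1 / s * ∫ ω, Complex.exp (s * ((A ω - B ω : ℝ) : ℂ)) ∂P := by
    intro s
    have h := IndepFun.integral_fun_mul_eq_mul_integral
      (hAB.comp (φ := fun x : ℝ => Complex.exp (s * x)) (ψ := fun x : ℝ => Complex.exp (-s * x))
        (by fun_prop) (by fun_prop))
      (AEMeasurable.aestronglyMeasurable (by fun_prop))
      (AEMeasurable.aestronglyMeasurable (by fun_prop))
    simp only [Function.comp_apply] at h
    rw [mul_assoc, ← h]
    congr 2
    ext ω
    rw [← Complex.exp_add]
    push_cast
    ring_nf
  refine ⟨fun R => ?_, ?_⟩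
  · simp_rw [hprod]
    exact intervalIntegrable_one_div_mul_integral_cexp hZ hc hZint _ _
  · have h := isInverseLaplaceAt_prob_pos hZ (hne.mono fun ω h => sub_ne_zero.2 h) hc hZint
      fun s _ => hprod s
    simpa only [sub_pos] using h

lemma IsInverseLaplaceAt.sub {H K : ℂ → ℂ} {c v w : ℝ} (hH : IsInverseLaplaceAt H c 0 v)
    (hK : IsInverseLaplaceAt K c 0 w)
    (hHi : ∀ R : ℝ, IntervalIntegrable (fun y : ℝ => H (c + y * Complex.I)) volume (-R) R)
    (hKi : ∀ R : ℝ, IntervalIntegrable (fun y : ℝ => K (c + y * Complex.I)) volume (-R) R) :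
    IsInverseLaplaceAt (fun s => H s - K s) c 0 (v - w) := by
  unfold IsInverseLaplaceAt at *
  simp only [Complex.ofReal_zero, mul_zero, Complex.exp_zero, one_mul] at *
  simp_rw [intervalIntegral.integral_sub (hHi _) (hKi _), mul_sub]
  push_cast
  exact Tendsto.sub hH hK

end Perron

/-! ### Sums of independent exponential variables -/

section Exponential

lemma expMeasure_Ioi {r : ℝ} (hr : 0 < r) (a : ℝ) :
    expMeasure r (Set.Ioi a) = ENNReal.ofReal (Real.exp (-(r * max a 0))) := by
  have := isProbabilityMeasure_expMeasure hr
  have h := cdf_expMeasure_eq hr a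
  rw [cdf_eq_real] at h
  rw [← ofReal_measureReal, ← Set.compl_Iic, probReal_compl_eq_one_sub measurableSet_Iic, h]
  split_ifs with ha
  · rw [max_eq_left ha, sub_sub_cancel]
  · rw [max_eq_right (not_le.1 ha).le]; simp

lemma expMeasure_eq_withDensity (r : ℝ) :
    expMeasure r = volume.withDensity (exponentialPDF r) := rfl

lemma measurable_exponentialPDF (r : ℝ) : Measurable (exponentialPDF r) :=
  (measurable_exponentialPDFReal r).ennreal_ofReal

lemma exponentialPDF_toReal_smul {r : ℝ} (hr : 0 < r) (s : ℂ) :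
    (fun x : ℝ => (exponentialPDF r x).toReal • Complex.exp (-s * x)) =
      (Set.Ici (0 : ℝ)).indicator fun x : ℝ => (r : ℂ) * Complex.exp (-(r + s) * x) := by
  ext x
  by_cases hx : 0 ≤ x
  · rw [Set.indicator_of_mem (Set.mem_Ici.2 hx), exponentialPDF_of_nonneg hx,
      ENNReal.toReal_ofReal (by positivity), Complex.real_smul]
    push_cast
    rw [mul_assoc, ← Complex.exp_add]
    ring_nf
  · rw [Set.indicator_of_notMem (by simpa using hx), exponentialPDF_of_neg (not_le.1 hx)]
    simp

lemma integrable_cexp_expMeasure {r : ℝ} (hr : 0 < r) {s : ℂ} (hs : -r < s.re) :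
    Integrable (fun x : ℝ => Complex.exp (-s * x)) (expMeasure r) := by
  rw [expMeasure_eq_withDensity, integrable_withDensity_iff_integrable_smul'
    (measurable_exponentialPDF r) (ae_of_all _ fun _ => ENNReal.ofReal_lt_top),
    exponentialPDF_toReal_smul hr, integrable_indicator_iff measurableSet_Ici,
    integrableOn_Ici_iff_integrableOn_Ioi]
  exact (integrableOn_exp_mul_complex_Ioi (by simp; linarith) 0).const_mul _

lemma integral_cexp_expMeasure {r : ℝ} (hr : 0 < r) {s : ℂ} (hs : -r < s.re) :
    ∫ x : ℝ, Complex.exp (-s * x) ∂(expMeasure r) = (r : ℂ) / (r + s) := by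
  rw [expMeasure_eq_withDensity, integral_withDensity_eq_integral_toReal_smul
    (measurable_exponentialPDF r) (ae_of_all _ fun _ => ENNReal.ofReal_lt_top),
    exponentialPDF_toReal_smul hr, integral_indicator measurableSet_Ici,
    integral_Ici_eq_integral_Ioi, integral_const_mul,
    integral_exp_mul_complex_Ioi (by simp; linarith)]
  simp [div_eq_mul_inv, -neg_add_rev]

variable {Ω : Type*} [MeasurableSpace Ω] {P : Measure Ω}

/-- Open right rays form a π-system generating the Borel sets, so joint tails determine the law. -/
lemma map_eq_pi_expMeasure [IsProbabilityMeasure P] {n : ℕ} {U : Fin n → Ω → ℝ} (hU : ∀ k, Measurable (U k))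
    {r : Fin n → ℝ} (hr : ∀ k, 0 < r k)
    (h : ∀ a : Fin n → ℝ, P {ω | ∀ k, a k < U k ω} =
      ∏ k, ENNReal.ofReal (Real.exp (-(r k * max (a k) 0)))) :
    P.map (fun ω k => U k ω) = Measure.pi fun k => expMeasure (r k) := by
  have := fun k => isProbabilityMeasure_expMeasure (hr k)
  symm
  refine Measure.pi_eq_generateFrom (C := fun _ => Set.range Set.Ioi)
    (fun _ => ((BorelSpace.measurable_eq (α := ℝ)).trans (borel_eq_generateFrom_Ioi ℝ)).symm)
    (fun _ => ?_) (fun k =>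
      ⟨fun n => Set.Ioi (-n : ℝ), fun n => ⟨_, rfl⟩, fun _ => measure_lt_top _ _, ?_⟩) ?_
  · rintro _ ⟨a, rfl⟩ _ ⟨b, rfl⟩ _
    exact ⟨a ⊔ b, Set.Ioi_inter_Ioi.symm⟩
  · refine Set.eq_univ_of_forall fun x => ?_
    obtain ⟨n, hn⟩ := exists_nat_gt (-x)
    exact Set.mem_iUnion.2 ⟨n, by simp; linarith⟩
  · intro s hs
    choose a ha using hs
    obtain rfl : (fun k => Set.Ioi (a k)) = s := funext ha
    rw [Measure.map_apply (by fun_prop) (MeasurableSet.univ_pi fun _ => measurableSet_Ioi)]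
    simp_rw [expMeasure_Ioi (hr _)]
    rw [← h]
    congr 1
    ext ω
    simp

lemma map_eq_expMeasure {n : ℕ} {U : Fin n → Ω → ℝ} (hU : ∀ k, Measurable (U k))
    {r : Fin n → ℝ} (hr : ∀ k, 0 < r k)
    (h : P.map (fun ω k => U k ω) = Measure.pi fun k => expMeasure (r k)) (k : Fin n) :
    P.map (U k) = expMeasure (r k) := by
  have := fun k => isProbabilityMeasure_expMeasure (hr k)
  rw [← (measurePreserving_eval (fun k => expMeasure (r k)) k).map_eq, ← h,
    Measure.map_map (measurable_pi_apply k) (by fun_prop)]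
  rfl

lemma iIndepFun_of_map_eq_pi_expMeasure [IsProbabilityMeasure P] {n : ℕ} {U : Fin n → Ω → ℝ} (hU : ∀ k, Measurable (U k))
    {r : Fin n → ℝ} (hr : ∀ k, 0 < r k)
    (h : P.map (fun ω k => U k ω) = Measure.pi fun k => expMeasure (r k)) : iIndepFun U P := by
  rw [iIndepFun_iff_map_fun_eq_pi_map fun k => (hU k).aemeasurable, h]
  simp_rw [map_eq_expMeasure hU hr h]

lemma cexp_neg_mul_sum {n : ℕ} (u : Fin n → ℝ) (s : ℂ) :
    Complex.exp (-s * ((∑ k, u k : ℝ) : ℂ)) = ∏ k, Complex.exp (-s * u k) := by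
  rw [← Complex.exp_sum, ← Finset.mul_sum]
  push_cast
  rfl

lemma integrable_cexp_sum_exp {n : ℕ} {U : Fin n → Ω → ℝ} (hU : ∀ k, Measurable (U k))
    {r : Fin n → ℝ} (hr : ∀ k, 0 < r k)
    (h : P.map (fun ω k => U k ω) = Measure.pi fun k => expMeasure (r k))
    {s : ℂ} (hs : ∀ k, -r k < s.re) :
    Integrable (fun ω => Complex.exp (-s * ((∑ k, U k ω : ℝ) : ℂ))) P := by
  have := fun k => isProbabilityMeasure_expMeasure (hr k)
  simp_rw [cexp_neg_mul_sum]
  have hi := Integrable.fintype_prod (μ := fun k => expMeasure (r k))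
    fun k => integrable_cexp_expMeasure (hr k) (hs k)
  rw [← h] at hi
  exact hi.comp_measurable (by fun_prop)

lemma integral_cexp_sum_exp [IsProbabilityMeasure P] {n : ℕ} {U : Fin n → Ω → ℝ} (hU : ∀ k, Measurable (U k))
    {r : Fin n → ℝ} (hr : ∀ k, 0 < r k)
    (h : P.map (fun ω k => U k ω) = Measure.pi fun k => expMeasure (r k))
    {s : ℂ} (hs : ∀ k, -r k < s.re) :
    ∫ ω, Complex.exp (-s * ((∑ k, U k ω : ℝ) : ℂ)) ∂P = ∏ k, (r k : ℂ) / (r k + s) := by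
  simp_rw [cexp_neg_mul_sum]
  rw [(iIndepFun_of_map_eq_pi_expMeasure hU hr h).integral_fun_prod_comp
    (X := U) (f := fun _ (x : ℝ) => Complex.exp (-s * x)) (fun k => (hU k).aemeasurable)
    (fun k => by fun_prop)]
  refine Finset.prod_congr rfl fun k _ => ?_
  rw [← integral_cexp_expMeasure (hr k) (hs k), ← map_eq_expMeasure hU hr h k,
    integral_map (hU k).aemeasurable (by fun_prop)]

/-- By Fubini the diagonal is null for the product law: its sections are single points, null for the
law of X. -/
lemma ae_ne_of_indepFun [IsProbabilityMeasure P] {X Y : Ω → ℝ} (hX : AEMeasurable X P) (hY : AEMeasurable Y P)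
    (h : IndepFun X Y P) (hX0 : ∀ x, P.map X {x} = 0) : ∀ᵐ ω ∂P, X ω ≠ Y ω := by
  have := Measure.isProbabilityMeasure_map hX
  have := Measure.isProbabilityMeasure_map hY
  have hmeas : MeasurableSet {p : ℝ × ℝ | p.1 ≠ p.2} :=
    (measurableSet_eq_fun measurable_fst measurable_snd).compl
  have hae : ∀ᵐ p ∂(P.map fun ω => (X ω, Y ω)), p.1 ≠ p.2 := by
    rw [(indepFun_iff_map_prod_eq_prod_map_map hX hY).1 h, ae_iff,
      Measure.prod_apply_symm (by simpa [Set.compl_def] using hmeas.compl)]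
    simp only [ne_eq, not_not, Set.preimage_ofPred_eq, Set.ofPred_eq_eq_singleton, hX0,
      lintegral_zero]
  exact (ae_map_iff (hX.prodMk hY) hmeas).1 hae

lemma map_sum_exp_singleton [IsProbabilityMeasure P] {n : ℕ} (hn : 0 < n) {U : Fin n → Ω → ℝ} (hU : ∀ k, Measurable (U k))
    {r : Fin n → ℝ} (hr : ∀ k, 0 < r k)
    (h : P.map (fun ω k => U k ω) = Measure.pi fun k => expMeasure (r k)) (x : ℝ) :
    P.map (fun ω => ∑ k, U k ω) {x} = 0 := by
  set i : Fin n := ⟨0, hn⟩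
  have hind := (iIndepFun_of_map_eq_pi_expMeasure hU hr h).indepFun_finsetSum_of_notMem hU
    (Finset.notMem_erase i Finset.univ)
  have hsum : Measurable (∑ j ∈ Finset.univ.erase i, U j) := by
    fun_prop
  -- One exponential summand is independent of x minus the others, and it already has no atoms.
  have hne := ae_ne_of_indepFun (hU i).aemeasurable (hsum.const_sub x).aemeasurable
    (hind.symm.comp measurable_id (measurable_id.const_sub x)) fun y => by
      rw [map_eq_expMeasure hU hr h, expMeasure_eq_withDensity]
      exact withDensity_absolutelyContinuous _ _ Real.volume_singleton
  rw [Measure.map_apply (by fun_prop) (measurableSet_singleton x)]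
  refine measure_mono_null (fun ω hω => ?_) (ae_iff.1 hne)
  simp only [Set.mem_preimage, Set.mem_singleton_iff] at hω
  rw [← Finset.add_sum_erase _ _ (Finset.mem_univ i)] at hω
  simp only [Finset.sum_apply, ne_eq, not_not, Set.mem_ofPred_eq]
  linarith

end Exponential

/-! ### Deterministic properties of jump paths -/

section Paths

/-- The first rational time at which the path `x` is in state `m`. -/
noncomputable def rationalPassage (m : ℕ) (x : ℝ≥0 → ℕ) : ℝ≥0∞ :=
  ⨅ r : ℚ, if x (Real.toNNReal r) = m then (Real.toNNReal r : ℝ≥0∞) else ∞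

lemma measurable_rationalPassage (m : ℕ) : Measurable (rationalPassage m) := by
  refine Measurable.iInf fun r => Measurable.ite ?_ measurable_const measurable_const
  exact measurableSet_eq_fun (measurable_pi_apply _) measurable_const

/-- The path `x` is equal to `y n` between the sum of the first `n` and that of the first `n + 1`
holding times `τ`, and is defined at all times in this way. -/
def IsJumpPath (y : ℕ → ℕ) (τ : ℕ → ℝ≥0∞) (x : ℝ≥0 → ℕ) : Prop :=
  ∀ t : ℝ≥0, ∃ n : ℕ, (∑ k ∈ Finset.range n, τ k) ≤ t ∧
    (t : ℝ≥0∞) < ∑ k ∈ Finset.range (n + 1), τ k ∧ x t = y n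

variable {y : ℕ → ℕ} {τ : ℕ → ℝ≥0∞} {x : ℝ≥0 → ℕ}

lemma sum_range_mono (τ : ℕ → ℝ≥0∞) : Monotone fun n => ∑ k ∈ Finset.range n, τ k :=
  fun _ _ h => Finset.sum_le_sum_of_subset (Finset.range_mono h)

lemma lt_of_sum_range_lt {a b : ℕ}
    (h : ∑ k ∈ Finset.range a, τ k < ∑ k ∈ Finset.range b, τ k) : a < b :=
  not_le.1 fun hab => (not_lt.2 (sum_range_mono τ hab)) h

lemma IsJumpPath.eq_of_mem (h : IsJumpPath y τ x) {n : ℕ} {t : ℝ≥0}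
    (h1 : ∑ k ∈ Finset.range n, τ k ≤ t) (h2 : (t : ℝ≥0∞) < ∑ k ∈ Finset.range (n + 1), τ k) :
    x t = y n := by
  obtain ⟨n', h1', h2', hx⟩ := h t
  have := lt_of_sum_range_lt (h1.trans_lt h2')
  have := lt_of_sum_range_lt (h1'.trans_lt h2)
  rw [hx, show n' = n by omega]

/-- A path keeps its state for a while after each t, so rational times just after t see the same
state. The uncountable infimum thus becomes a measurable function of the path. -/
lemma IsJumpPath.iInf_eq_rationalPassage (h : IsJumpPath y τ x) (m : ℕ) :
    ⨅ (t : ℝ≥0) (_ : x t = m), (t : ℝ≥0∞) = rationalPassage m x := by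
  apply le_antisymm
  · refine le_iInf fun r => ?_
    split_ifs with hr
    · exact iInf_le_of_le _ (iInf_le _ hr)
    · exact le_top
  · refine le_iInf₂ fun t ht => le_of_forall_gt fun u hu => ?_
    obtain ⟨n, h1, h2, hx⟩ := h t
    obtain ⟨r, -, hr1, hr2⟩ := ENNReal.lt_iff_exists_rat_btwn.1 (lt_min hu h2)
    have hxr : x (Real.toNNReal r) = m := by
      rw [h.eq_of_mem (h1.trans hr1.le) (hr2.trans_le (min_le_right _ _)), ← hx, ht]
    refine lt_of_le_of_lt (iInf_le _ r) ?_
    rw [if_pos hxr]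
    exact hr2.trans_le (min_le_left _ _)

lemma IsJumpPath.iInf_pos (h : IsJumpPath y τ x) {m : ℕ} (hy : y 0 ≠ m) (hτ : 0 < τ 0) :
    0 < ⨅ (t : ℝ≥0) (_ : x t = m), (t : ℝ≥0∞) := by
  refine hτ.trans_le (le_iInf₂ fun t ht => ?_)
  obtain ⟨n, h1, h2, hx⟩ := h t
  have hn : 1 ≤ n := by
    rcases Nat.eq_zero_or_pos n with rfl | hn
    · exact absurd (hx.symm.trans ht) hy
    · exact hn
  exact le_trans (by simpa using sum_range_mono τ hn) h1

/-- Truncated subtraction makes `q - k` stay at 0 after q jumps, so one formula covers absorption.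
-/
lemma IsJumpPath.le_iff {q : ℕ} (h : IsJumpPath (fun k => q - k) τ x) {m : ℕ} (hm : m ≤ q)
    (t : ℝ≥0) : x t ≤ m ↔ ∑ k ∈ Finset.range (q - m), τ k ≤ t := by
  obtain ⟨n, h1, h2, hx⟩ := h t
  rw [hx]
  change q - n ≤ m ↔ _
  constructor
  · intro hn
    exact (sum_range_mono τ (show q - m ≤ n by omega)).trans h1
  · intro hs
    have := lt_of_sum_range_lt (hs.trans_lt h2)
    omega

lemma IsJumpPath.iInf_eq_sum {q : ℕ} (h : IsJumpPath (fun k => q - k) τ x) {m : ℕ} (hm : m ≤ q)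
    (hpos : ∀ k, 0 < τ k) (hfin : ∀ k < q, τ k ≠ ∞) :
    ⨅ (t : ℝ≥0) (_ : x t = m), (t : ℝ≥0∞) = ∑ k ∈ Finset.range (q - m), τ k := by
  have hS : ∑ k ∈ Finset.range (q - m), τ k ≠ ∞ := by
    rw [ENNReal.sum_ne_top]
    intro k hk
    exact hfin k (by have := Finset.mem_range.1 hk; omega)
  apply le_antisymm
  · have hcoe := ENNReal.coe_toNNReal hS
    have hxt : x (∑ k ∈ Finset.range (q - m), τ k).toNNReal = m := by
      rw [h.eq_of_mem (n := q - m) hcoe.ge]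
      · omega
      · rw [hcoe, Finset.sum_range_succ]
        exact ENNReal.lt_add_right hS (hpos _).ne'
    exact iInf_le_of_le _ (iInf_le_of_le hxt hcoe.le)
  · exact le_iInf₂ fun t ht => (h.le_iff hm t).1 ht.le

end Paths

/-! ### Passage times and holding times of the processes -/

section Processes

variable {Ω : Type*} [MeasurableSpace Ω] {P : Measure Ω}

lemma IsBirthDeath.firstPassage_ae_eq {b d : ℕ → ℝ} {x₀ : ℕ} {X : ℝ≥0 → Ω → ℕ}
    (h : IsBirthDeath P b d x₀ X) (m : ℕ) :
    firstPassage X m =ᵐ[P] fun ω => rationalPassage m fun t => X t ω := by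
  obtain ⟨-, Y, T, -, -, -, hpath⟩ := h
  filter_upwards [hpath] with ω hω
  exact IsJumpPath.iInf_eq_rationalPassage (y := (Y · ω)) (τ := (T · ω)) hω m

lemma IsBirthDeath.measurable_rationalPassage_comp {b d : ℕ → ℝ} {x₀ : ℕ} {X : ℝ≥0 → Ω → ℕ}
    (h : IsBirthDeath P b d x₀ X) (m : ℕ) :
    Measurable fun ω => rationalPassage m fun t => X t ω :=
  (measurable_rationalPassage m).comp (measurable_pi_lambda _ h.1)

lemma IsBirthDeath.aemeasurable_firstPassage {b d : ℕ → ℝ} {x₀ : ℕ} {X : ℝ≥0 → Ω → ℕ}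
    (h : IsBirthDeath P b d x₀ X) (m : ℕ) : AEMeasurable (firstPassage X m) P :=
  ⟨_, h.measurable_rationalPassage_comp m, h.firstPassage_ae_eq m⟩

/-- The path stays at x₀ ≥ 1 during the first holding time, so it suffices that this is positive.
The law only gives probabilities with the next state prescribed, so one sums over the targets of the
first jump. -/
lemma IsBirthDeath.firstPassage_pos [IsProbabilityMeasure P] {b d : ℕ → ℝ} {x₀ : ℕ}
    {X : ℝ≥0 → Ω → ℕ} (h : IsBirthDeath P b d x₀ X) (hb : ∀ k, 0 ≤ b k) (hd : ∀ k, 0 ≤ d k)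
    (hx₀ : 1 ≤ x₀) : ∀ᵐ ω ∂P, 0 < firstPassage X 0 ω := by
  obtain ⟨-, Y, T, hY, hT, hlaw, hpath⟩ := h
  set A : ℕ → Set Ω := fun j => {ω | Y 0 ω = x₀ ∧ Y 1 ω = j ∧ 0 < T 0 ω}
  have hAm : ∀ j, MeasurableSet (A j) := fun j =>
    (hY 0 (measurableSet_singleton x₀)).inter ((hY 1 (measurableSet_singleton j)).inter
      (measurableSet_lt measurable_const (hT 0)))
  have hA : ∀ j, P (A j) = ENNReal.ofReal (jumpProb b d x₀ j) := by
    intro j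
    have := hlaw 1 (fun k => if k = 0 then x₀ else j) 0
    simp only [if_true, Finset.range_one, Finset.prod_singleton, zero_add, one_ne_zero, if_false,
      Pi.zero_apply, NNReal.coe_zero, mul_zero, neg_zero, Real.exp_zero, mul_one] at this
    rw [← this]
    congr 1
    ext ω
    constructor
    · rintro ⟨h0, h1, hT⟩
      refine ⟨fun k hk => ?_, fun k hk => ?_⟩
      · interval_cases k <;> simpa
      · interval_cases k; simpa using hT
    · rintro ⟨h1, h2⟩
      exact ⟨by simpa using h1 0 (by omega), by simpa using h1 1 le_rfl,
        by simpa using h2 0 one_pos⟩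
  have hsum : ∃ s : Finset ℕ, 1 ≤ ∑ j ∈ s, jumpProb b d x₀ j := by
    by_cases h0 : totalRate b d x₀ = 0
    · exact ⟨{x₀}, by simp [jumpProb, h0]⟩
    · refine ⟨{x₀ + 1, x₀ - 1}, ?_⟩
      rw [Finset.sum_pair (by omega)]
      have e : totalRate b d x₀ = b x₀ + d x₀ := by
        simp [totalRate, show x₀ ≠ 0 by omega]
      have h1 : jumpProb b d x₀ (x₀ + 1) = b x₀ / totalRate b d x₀ := by
        simp [jumpProb, h0]
      have h2 : jumpProb b d x₀ (x₀ - 1) = d x₀ / totalRate b d x₀ := by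
        simp [jumpProb, h0, show x₀ - 1 ≠ x₀ + 1 by omega, show x₀ - 1 + 1 = x₀ by omega]
      rw [h1, h2, ← add_div, ← e, div_self h0]
  have hnn : ∀ j, 0 ≤ jumpProb b d x₀ j := by
    intro j
    have : 0 ≤ totalRate b d x₀ := by
      unfold totalRate
      split_ifs
      · simpa using hb x₀
      · exact add_nonneg (hb _) (hd _)
    unfold jumpProb
    split_ifs
    · exact zero_le_one
    · exact le_rfl
    · exact div_nonneg (hb _) this
    · exact div_nonneg (hd _) this
    · exact le_rfl
  obtain ⟨s, hs⟩ := hsum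
  have hdisj : Set.PairwiseDisjoint (s : Set ℕ) A := by
    intro i _ j _ hij
    exact Set.disjoint_left.2 fun ω h1 h2 => hij (h1.2.1.symm.trans h2.2.1)
  have hone : P (⋃ j ∈ s, A j) = 1 := by
    apply le_antisymm prob_le_one
    rw [measure_biUnion_finset hdisj fun j _ => hAm j]
    simp_rw [hA]
    rw [← ENNReal.ofReal_sum_of_nonneg fun j _ => hnn j]
    exact ENNReal.one_le_ofReal.2 hs
  have hae : ∀ᵐ ω ∂P, ω ∈ ⋃ j ∈ s, A j :=
    (mem_ae_iff_prob_eq_one (Finset.measurableSet_biUnion s fun j _ => hAm j)).2 hone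
  filter_upwards [hae, hpath] with ω hω hp
  obtain ⟨j, -, hj⟩ := Set.mem_iUnion₂.1 hω
  exact IsJumpPath.iInf_pos (y := (Y · ω)) (τ := (T · ω)) hp (by have := hj.1; omega)
    hj.2.2

lemma jumpProb_pureDeath {d : ℕ → ℝ} {x : ℕ} (h : x = 0 ∨ d x ≠ 0) :
    jumpProb (fun _ => 0) d x (x - 1) = 1 := by
  rcases Nat.eq_zero_or_pos x with rfl | hx
  · simp [jumpProb, totalRate]
  · have hd := h.resolve_left hx.ne'
    have ht : totalRate (fun _ => 0) d x = d x := by simp [totalRate, hx.ne']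
    simp [jumpProb, ht, hd, show x - 1 ≠ x + 1 by omega, show x - 1 + 1 = x by omega]

/-- The embedded chain is almost surely the deterministic sequence `q - k`, so the prescribed law
reduces to the joint tail of the holding times. -/
lemma IsPureDeath.exists_holdingTimes [IsProbabilityMeasure P] {d : ℕ → ℝ} {q : ℕ}
    {X : ℝ≥0 → Ω → ℕ} (h : IsPureDeath P d q X) (hd : ∀ k, 1 ≤ k → k ≤ q → 0 < d k) :
    ∃ T : ℕ → Ω → ℝ≥0∞, (∀ k, Measurable (T k)) ∧
      (∀ᵐ ω ∂P, ∀ k < q, T k ω ≠ ∞) ∧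
      (∀ᵐ ω ∂P, ∀ m ≤ q, firstPassage X m ω = ∑ k ∈ Finset.range (q - m), T k ω) ∧
      (∀ᵐ ω ∂P, ∀ m ≤ q, ∀ t : ℝ≥0, X t ω ≤ m ↔ firstPassage X m ω ≤ t) ∧
      ∀ n ≤ q, P.map (fun ω (k : Fin n) => (T k ω).toReal) =
        Measure.pi fun k : Fin n => expMeasure (d (q - k)) := by
  obtain ⟨-, Y, T, hY, hT, hlaw, hpath⟩ := h
  have hlaw' : ∀ n (t : ℕ → ℝ≥0),
      P {ω | (∀ k ≤ n, Y k ω = q - k) ∧ ∀ k < n, (t k : ℝ≥0∞) < T k ω} =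
        ENNReal.ofReal (∏ k ∈ Finset.range n,
          Real.exp (-(totalRate (fun _ => 0) d (q - k) * t k))) := by
    intro n t
    rw [hlaw n (fun k => q - k) t, if_pos (Nat.sub_zero q)]
    congr 1
    refine Finset.prod_congr rfl fun k _ => ?_
    rw [← Nat.sub_sub, jumpProb_pureDeath, one_mul]
    rcases Nat.eq_zero_or_pos (q - k) with h0 | h0
    · exact Or.inl h0
    · exact Or.inr (hd _ h0 (Nat.sub_le _ _)).ne'
  have hmeas : ∀ n (t : ℕ → ℝ≥0),
      MeasurableSet {ω | (∀ k ≤ n, Y k ω = q - k) ∧ ∀ k < n, (t k : ℝ≥0∞) < T k ω} := by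
    intro n t
    simp only [Set.ofPred_and, Set.ofPred_forall]
    refine MeasurableSet.inter ?_ ?_
    · exact MeasurableSet.iInter fun k => MeasurableSet.iInter fun _ =>
        hY k (measurableSet_singleton _)
    · exact MeasurableSet.iInter fun k => MeasurableSet.iInter fun _ =>
        measurableSet_lt measurable_const (hT k)
  have hgood : ∀ᵐ ω ∂P, ∀ n, Y n ω = q - n ∧ 0 < T n ω := by
    rw [ae_all_iff]
    intro n
    -- With all thresholds 0 the exponential factors are 1.
    have h1 : P {ω | (∀ k ≤ n + 1, Y k ω = q - k) ∧
        ∀ k < n + 1, (((0 : ℕ → ℝ≥0) k : ℝ≥0) : ℝ≥0∞) < T k ω} = 1 := by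
      rw [hlaw']; simp
    filter_upwards [(mem_ae_iff_prob_eq_one (hmeas _ _)).2 h1] with ω hω
    exact ⟨hω.1 n (by omega), by simpa using hω.2 n (by omega)⟩
  have hfin : ∀ᵐ ω ∂P, ∀ k < q, T k ω ≠ ∞ := by
    rw [ae_all_iff]
    intro k
    by_cases hk : k < q
    swap
    · exact ae_of_all _ fun ω h => absurd h hk
    have hr : 0 < d (q - k) := hd _ (by omega) (by omega)
    -- Threshold t in place k and 0 elsewhere; then t → ∞, the rate being positive for k < q.
    have hle : ∀ t : ℝ≥0, P {ω | T k ω = ∞} ≤ ENNReal.ofReal (Real.exp (-(d (q - k) * t))) := by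
      intro t
      have h1 := hlaw' (k + 1) (fun j => if j = k then t else 0)
      rw [Finset.prod_range_succ, Finset.prod_eq_one, one_mul] at h1
      · simp only [if_true, totalRate, show q - k ≠ 0 by omega, if_false, zero_add] at h1
        rw [← h1]
        refine measure_mono_ae ?_
        filter_upwards [hgood] with ω hω hωk
        refine ⟨fun j _ => (hω j).1, fun j _ => ?_⟩
        split_ifs with hj
        · subst hj
          rw [show T j ω = ∞ from hωk]
          exact ENNReal.coe_lt_top
        · simpa using (hω j).2
      · intro j hj
        simp [(Finset.mem_range.1 hj).ne]
    have hlim : Tendsto (fun t : ℝ≥0 => ENNReal.ofReal (Real.exp (-(d (q - k) * t)))) atTop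
        (𝓝 0) := by
      rw [← ENNReal.ofReal_zero]
      refine ENNReal.tendsto_ofReal (Real.tendsto_exp_neg_atTop_nhds_zero.comp ?_)
      exact Tendsto.const_mul_atTop hr (NNReal.tendsto_coe_atTop.2 tendsto_id)
    have h0 : P {ω | T k ω = ∞} = 0 := le_antisymm (ge_of_tendsto' hlim hle) zero_le
    rw [ae_iff]
    simpa [hk] using h0
  have hjump : ∀ᵐ ω ∂P, IsJumpPath (fun k => q - k) (T · ω) (X · ω) := by
    filter_upwards [hgood, hpath] with ω hω hp t
    obtain ⟨n, h1, h2, h3⟩ := hp t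
    exact ⟨n, h1, h2, h3.trans (hω n).1⟩
  have hpass : ∀ᵐ ω ∂P, ∀ m ≤ q, firstPassage X m ω = ∑ k ∈ Finset.range (q - m), T k ω := by
    filter_upwards [hgood, hfin, hjump] with ω hω hf hj m hm
    exact hj.iInf_eq_sum hm (fun k => (hω k).2) hf
  refine ⟨T, hT, hfin, hpass, ?_, fun n hn => ?_⟩
  · filter_upwards [hjump, hpass] with ω hj hp m hm t
    rw [hp m hm]
    exact hj.le_iff hm t
  · refine map_eq_pi_expMeasure (fun k => (hT k).ennreal_toReal)
      (fun k => hd _ (by omega) (by omega)) fun a => ?_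
    -- Negative thresholds are clipped to 0, which changes the event only on a null set since the
    -- holding times are almost surely positive.
    set t : ℕ → ℝ≥0 := fun k => if hk : k < n then (a ⟨k, hk⟩).toNNReal else 0
    have h1 := hlaw' n t
    rw [ENNReal.ofReal_prod_of_nonneg fun _ _ => (Real.exp_pos _).le,
      ← Fin.prod_univ_eq_prod_range
        (fun k => ENNReal.ofReal (Real.exp (-(totalRate (fun _ => 0) d (q - k) * t k)))) n] at h1
    convert h1 using 1
    · refine measure_congr ?_
      filter_upwards [hgood, hfin] with ω hω hf
      refine propext ⟨fun H => ⟨fun k _ => (hω k).1, fun k hk => ?_⟩, fun H k => ?_⟩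
      · have h2 := H ⟨k, hk⟩
        simp only [t, hk, dif_pos]
        rcases le_or_gt (a ⟨k, hk⟩) 0 with h3 | h3
        · rw [Real.toNNReal_of_nonpos h3]
          simpa using (hω k).2
        · rw [← ENNReal.ofReal]
          exact (ENNReal.ofReal_lt_iff_lt_toReal h3.le (hf k (hk.trans_le hn))).2 h2
      · have h2 := H.2 k k.2
        simp only [t, k.2, dif_pos, Fin.eta] at h2
        rcases lt_or_ge (a k) 0 with h3 | h3
        · exact h3.trans_le ENNReal.toReal_nonneg
        · rw [← ENNReal.ofReal] at h2
          exact (ENNReal.ofReal_lt_iff_lt_toReal h3 (hf k (k.2.trans_le hn))).1 h2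
    · refine Finset.prod_congr rfl fun k _ => ?_
      have hk : q - (k : ℕ) ≠ 0 := by omega
      simp [t, totalRate, hk, Real.coe_toNNReal']

end Processes

/-! ### Transforms, ties, and events in terms of passage times -/

section PassageTimes

variable {Ω : Type*} [MeasurableSpace Ω] {P : Measure Ω}

lemma laplace_eq_integral {τ : Ω → ℝ≥0∞} (hτ : ∀ᵐ ω ∂P, τ ω ≠ ∞) (s : ℂ) :
    laplace P τ s = ∫ ω, Complex.exp (-s * ((τ ω).toReal : ℂ)) ∂P := by
  have : {ω | τ ω ≠ ∞} =ᵐ[P] Set.univ := by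
    filter_upwards [hτ] with ω hω
    exact propext ⟨fun _ => trivial, fun _ => hω⟩
  rw [laplace, Measure.restrict_congr_set this, Measure.restrict_univ]

lemma laplace_neg_eq_integral {τ : Ω → ℝ≥0∞} (hτ : ∀ᵐ ω ∂P, τ ω ≠ ∞) (s : ℂ) :
    laplace P τ (-s) = ∫ ω, Complex.exp (s * ((τ ω).toReal : ℂ)) ∂P := by
  rw [laplace_eq_integral hτ, neg_neg]

/-- The Bromwich integral of `(1 / s) E[exp (s σ)] E[exp (- s τ)]` for independent times. -/
lemma isInverseLaplaceAt_laplace [IsProbabilityMeasure P] {σ τ : Ω → ℝ≥0∞} (hσ : AEMeasurable σ P)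
    (hτ : AEMeasurable τ P) (hσ' : ∀ᵐ ω ∂P, σ ω ≠ ∞) (hτ' : ∀ᵐ ω ∂P, τ ω ≠ ∞)
    (hind : IndepFun σ τ P) (hne : ∀ᵐ ω ∂P, τ ω ≠ σ ω) {c : ℝ} (hc : 0 < c)
    (hint : Integrable (fun ω => Real.exp (c * (σ ω).toReal)) P) :
    (∀ R : ℝ, IntervalIntegrable (fun y : ℝ => 1 / (c + y * Complex.I) *
      laplace P σ (-(c + y * Complex.I)) * laplace P τ (c + y * Complex.I)) volume (-R) R) ∧
    IsInverseLaplaceAt (fun s => 1 / s * laplace P σ (-s) * laplace P τ s) c 0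
      (P.real {ω | τ ω < σ ω}) := by
  have hset : P.real {ω | τ ω < σ ω} = P.real {ω | (τ ω).toReal < (σ ω).toReal} := by
    refine measureReal_congr ?_
    filter_upwards [hσ', hτ'] with ω h1 h2
    exact propext (ENNReal.toReal_lt_toReal h2 h1).symm
  simp_rw [laplace_neg_eq_integral hσ', laplace_eq_integral hτ', hset]
  refine isInverseLaplaceAt_prob_lt (A := fun ω => (σ ω).toReal) (B := fun ω => (τ ω).toReal)
    hσ.ennreal_toReal hτ.ennreal_toReal
    (hind.comp (φ := ENNReal.toReal) (ψ := ENNReal.toReal) ENNReal.measurable_toReal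
      ENNReal.measurable_toReal) ?_ (fun _ => ENNReal.toReal_nonneg) hc hint
  filter_upwards [hne, hσ', hτ'] with ω h1 h2 h3 h4
  exact h1 ((ENNReal.toReal_eq_toReal_iff' h3 h2).1 h4.symm)

lemma IsPureDeath.laplace_firstPassage [IsProbabilityMeasure P] {d : ℕ → ℝ} {q : ℕ}
    {X : ℝ≥0 → Ω → ℕ} (h : IsPureDeath P d q X) (hd : ∀ k, 1 ≤ k → k ≤ q → 0 < d k) {m : ℕ}
    (hm : m ≤ q) :
    (∀ᵐ ω ∂P, firstPassage X m ω ≠ ∞) ∧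
      ∀ s : ℂ, (∀ k ∈ Finset.Icc (m + 1) q, -d k < s.re) →
        Integrable (fun ω => Complex.exp (-s * ((firstPassage X m ω).toReal : ℂ))) P ∧
        laplace P (firstPassage X m) s =
          ∏ k ∈ Finset.Icc (m + 1) q, (d k : ℂ) / ((d k : ℂ) + s) := by
  obtain ⟨T, hT, hfin, hpass, -, hlaw⟩ := h.exists_holdingTimes hd
  have hne : ∀ᵐ ω ∂P, firstPassage X m ω ≠ ∞ := by
    filter_upwards [hfin, hpass] with ω hf hp
    rw [hp m hm, ENNReal.sum_ne_top]
    intro k hk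
    exact hf k (by have := Finset.mem_range.1 hk; omega)
  refine ⟨hne, fun s hs => ?_⟩
  have hsum : ∀ᵐ ω ∂P, (firstPassage X m ω).toReal = ∑ k : Fin (q - m), (T k ω).toReal := by
    filter_upwards [hfin, hpass] with ω hf hp
    rw [hp m hm, ENNReal.toReal_sum, Fin.sum_univ_eq_sum_range (fun k => (T k ω).toReal)]
    intro k hk
    exact hf k (by have := Finset.mem_range.1 hk; omega)
  have hr : ∀ k : Fin (q - m), 0 < d (q - k) := fun k => hd _ (by omega) (by omega)
  have hs' : ∀ k : Fin (q - m), -d (q - k) < s.re := fun k =>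
    hs _ (Finset.mem_Icc.2 ⟨by omega, by omega⟩)
  have hU : ∀ k : Fin (q - m), Measurable fun ω => (T k ω).toReal := fun k =>
    (hT k).ennreal_toReal
  have hcongr : (fun ω => Complex.exp (-s * ((firstPassage X m ω).toReal : ℂ))) =ᵐ[P]
      fun ω => Complex.exp (-s * ((∑ k : Fin (q - m), (T k ω).toReal : ℝ) : ℂ)) := by
    filter_upwards [hsum] with ω h
    rw [h]
  refine ⟨(integrable_cexp_sum_exp hU hr (hlaw _ (Nat.sub_le _ _)) hs').congr hcongr.symm, ?_⟩
  rw [laplace_eq_integral hne, integral_congr_ae hcongr,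
    integral_cexp_sum_exp hU hr (hlaw _ (Nat.sub_le _ _)) hs']
  refine Finset.prod_bij (fun k _ => q - (k : ℕ)) (fun k _ => ?_) (fun a _ b _ hab => ?_)
    (fun k hk => ?_) (fun _ _ => rfl)
  · exact Finset.mem_Icc.2 ⟨by omega, by omega⟩
  · ext; omega
  · have := Finset.mem_Icc.1 hk
    exact ⟨⟨q - k, by omega⟩, Finset.mem_univ _, by simp; omega⟩

lemma IsPureDeath.ae_firstPassage_ne [IsProbabilityMeasure P] {d : ℕ → ℝ} {q : ℕ}
    {X : ℝ≥0 → Ω → ℕ} (h : IsPureDeath P d q X) (hd : ∀ k, 1 ≤ k → k ≤ q → 0 < d k)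
    {σ : Ω → ℝ≥0∞} (hσ : AEMeasurable σ P) (hpos : ∀ᵐ ω ∂P, 0 < σ ω) {m : ℕ} (hm : m ≤ q)
    (hind : IndepFun σ (firstPassage X m) P) :
    ∀ᵐ ω ∂P, firstPassage X m ω ≠ σ ω := by
  obtain ⟨T, hT, hTfin, hpass, -, hlaw⟩ := h.exists_holdingTimes hd
  rcases hm.lt_or_eq with hlt | rfl
  · have hsum : (fun ω => (firstPassage X m ω).toReal) =ᵐ[P]
        fun ω => ∑ k : Fin (q - m), (T k ω).toReal := by
      filter_upwards [hTfin, hpass] with ω hf hp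
      rw [hp m hm, ENNReal.toReal_sum, Fin.sum_univ_eq_sum_range (fun k => (T k ω).toReal)]
      intro k hk
      exact hf k (by have := Finset.mem_range.1 hk; omega)
    have hne := ae_ne_of_indepFun (X := fun ω => (firstPassage X m ω).toReal)
      (Y := fun ω => (σ ω).toReal)
      (h.aemeasurable_firstPassage m).ennreal_toReal hσ.ennreal_toReal
      (hind.symm.comp (φ := ENNReal.toReal) (ψ := ENNReal.toReal) ENNReal.measurable_toReal
        ENNReal.measurable_toReal) fun x => by
          rw [Measure.map_congr hsum]
          exact map_sum_exp_singleton (by omega) (fun k => (hT k).ennreal_toReal)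
            (fun k => hd _ (by omega) (by omega)) (hlaw _ (Nat.sub_le _ _)) x
    exact hne.mono fun ω h1 h2 => h1 (congrArg _ h2)
  -- Here m = q: the passage time is an empty sum, hence 0, and has an atom; positivity of σ
  -- excludes the tie.
  · filter_upwards [hpass, hpos] with ω hp h0
    rw [hp m le_rfl]
    simpa using h0.ne

lemma measureReal_le_eq_lt {σ τ : Ω → ℝ≥0∞} (hne : ∀ᵐ ω ∂P, τ ω ≠ σ ω) :
    P.real {ω | τ ω ≤ σ ω} = P.real {ω | τ ω < σ ω} := by
  refine measureReal_congr ?_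
  filter_upwards [hne] with ω h
  exact propext ⟨fun h' => lt_of_le_of_ne h' h, le_of_lt⟩

/-- The number of remaining orders in terms of the passage times of the cancellation process. -/
lemma remainingProb_eq [IsProbabilityMeasure P] {d : ℕ → ℝ} {q : ℕ} {Q X : ℝ≥0 → Ω → ℕ}
    (h : IsPureDeath P d q X) (hd : ∀ k, 1 ≤ k → k ≤ q → 0 < d k)
    (hfin : ∀ᵐ ω ∂P, firstPassage Q 0 ω ≠ ∞) {m : ℕ} (hm : 2 ≤ m) (hmq : m ≤ q) :
    remainingProb P Q X m = P.real {ω | firstPassage X m ω ≤ firstPassage Q 0 ω ∧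
      firstPassage Q 0 ω < firstPassage X (m - 1) ω} := by
  obtain ⟨T, -, -, -, hle, -⟩ := h.exists_holdingTimes hd
  refine measureReal_congr ?_
  filter_upwards [hle, hfin] with ω hω hf
  refine propext ?_
  change (quoteTime Q ω ≠ ∞ ∧ remaining X (quoteTime Q ω).toNNReal ω = m) ↔
    (firstPassage X m ω ≤ firstPassage Q 0 ω ∧ firstPassage Q 0 ω < firstPassage X (m - 1) ω)
  have h1 := hω m hmq (quoteTime Q ω).toNNReal
  have h2 := hω (m - 1) (by omega) (quoteTime Q ω).toNNReal
  unfold remaining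
  unfold quoteTime at *
  rw [ENNReal.coe_toNNReal hf] at h1 h2
  -- For m ≥ 2 the maximum with 1 is invisible; what remains is `X ≤ m` and not `X ≤ m - 1`.
  rw [← h1, ← not_le, ← h2]
  constructor
  · rintro ⟨-, h3⟩; omega
  · intro h3; exact ⟨hf, by omega⟩

/-- The maximum with 1 merges states 0 and 1, so a single inequality suffices. -/
lemma remainingProb_one_eq [IsProbabilityMeasure P] {d : ℕ → ℝ} {q : ℕ} {Q X : ℝ≥0 → Ω → ℕ}
    (h : IsPureDeath P d q X) (hd : ∀ k, 1 ≤ k → k ≤ q → 0 < d k)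
    (hfin : ∀ᵐ ω ∂P, firstPassage Q 0 ω ≠ ∞) (hq : 1 ≤ q) :
    remainingProb P Q X 1 = P.real {ω | firstPassage X 1 ω ≤ firstPassage Q 0 ω} := by
  obtain ⟨T, -, -, -, hle, -⟩ := h.exists_holdingTimes hd
  refine measureReal_congr ?_
  filter_upwards [hle, hfin] with ω hω hf
  refine propext ?_
  change (quoteTime Q ω ≠ ∞ ∧ remaining X (quoteTime Q ω).toNNReal ω = 1) ↔
    firstPassage X 1 ω ≤ firstPassage Q 0 ω
  have h1 := hω 1 hq (quoteTime Q ω).toNNReal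
  unfold remaining
  unfold quoteTime at *
  rw [ENNReal.coe_toNNReal hf] at h1
  rw [← h1]
  constructor
  · rintro ⟨-, h3⟩; omega
  · intro h3; exact ⟨hf, by omega⟩

end PassageTimes

end LimitOrderBook

/-! ### Assembly of the four claims -/

theorem mainTheorem6 {Ω : Type*} [MeasurableSpace Ω] (P : Measure Ω) [IsProbabilityMeasure P]
    -- rates at the best quote: limit orders, market orders, cancellations
    (lam mu phi : ℕ → ℝ)
    (hlam : ∀ k, 0 ≤ lam k) (hmu : ∀ k, 0 ≤ mu k) (hphi : ∀ k, 0 ≤ phi k)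
    -- initial queue size at the best quote and at the deeper level
    (qBest q : ℕ) (hqBest : 1 ≤ qBest) (hq : 1 ≤ q)
    -- cancellation rates at the deeper level
    (phiDeep : ℕ → ℝ) (hphiDeep : ∀ k, 1 ≤ k → k ≤ q → 0 < phiDeep k)
    -- the best-quote queue, and the cancellation-only process at the deeper level
    (Q Wt : ℝ≥0 → Ω → ℕ)
    (hQ : LimitOrderBook.IsBirthDeath P lam (fun k => mu k + phi k) qBest Q)
    (hWt : LimitOrderBook.IsPureDeath P phiDeep q Wt)
    (hindep : IndepFun (fun ω t => Q t ω) (fun ω t => Wt t ω) P)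
    (hfin : ∀ᵐ ω ∂P, LimitOrderBook.firstPassage Q 0 ω ≠ ∞) :
    -- Laplace transform of the passage time from `q` to `m`
    (∀ m ≤ q, (∀ᵐ ω ∂P, LimitOrderBook.firstPassage Wt m ω ≠ ∞) ∧
      ∀ s : ℂ, (∀ k ∈ Finset.Icc (m + 1) q, -phiDeep k < s.re) →
        Integrable (fun ω =>
          Complex.exp (-s * ((LimitOrderBook.firstPassage Wt m ω).toReal : ℂ))) P ∧
        LimitOrderBook.laplace P (LimitOrderBook.firstPassage Wt m) s =
          ∏ k ∈ Finset.Icc (m + 1) q, (phiDeep k : ℂ) / ((phiDeep k : ℂ) + s)) ∧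
    -- `m = q`
    (2 ≤ q →
      LimitOrderBook.remainingProb P Q Wt q =
        P.real {ω | LimitOrderBook.firstPassage Q 0 ω <
          LimitOrderBook.firstPassage Wt (q - 1) ω} ∧
      ∀ c : ℝ, 0 < c → c < phiDeep q →
        LimitOrderBook.IsInverseLaplaceAt
          (fun s => 1 / s * LimitOrderBook.laplace P (LimitOrderBook.firstPassage Q 0) s *
            LimitOrderBook.laplace P (LimitOrderBook.firstPassage Wt (q - 1)) (-s))
          c 0 (LimitOrderBook.remainingProb P Q Wt q)) ∧
    -- `1 < m < q`
    (∀ m, 1 < m → m < q →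
      LimitOrderBook.remainingProb P Q Wt m =
        P.real {ω | LimitOrderBook.firstPassage Wt m ω < LimitOrderBook.firstPassage Q 0 ω} -
        P.real {ω | LimitOrderBook.firstPassage Wt (m - 1) ω <
          LimitOrderBook.firstPassage Q 0 ω} ∧
      ∀ c : ℝ, 0 < c →
        Integrable (fun ω => Real.exp (c * (LimitOrderBook.firstPassage Q 0 ω).toReal)) P →
        LimitOrderBook.IsInverseLaplaceAt
          (fun s => 1 / s * LimitOrderBook.laplace P (LimitOrderBook.firstPassage Q 0) (-s) *
            (LimitOrderBook.laplace P (LimitOrderBook.firstPassage Wt m) s -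
              LimitOrderBook.laplace P (LimitOrderBook.firstPassage Wt (m - 1)) s))
          c 0 (LimitOrderBook.remainingProb P Q Wt m)) ∧
    -- `m = 1`
    (LimitOrderBook.remainingProb P Q Wt 1 =
        P.real {ω | LimitOrderBook.firstPassage Wt 1 ω < LimitOrderBook.firstPassage Q 0 ω} ∧
      ∀ c : ℝ, 0 < c →
        Integrable (fun ω => Real.exp (c * (LimitOrderBook.firstPassage Q 0 ω).toReal)) P →
        LimitOrderBook.IsInverseLaplaceAt
          (fun s => 1 / s * LimitOrderBook.laplace P (LimitOrderBook.firstPassage Q 0) (-s) *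
            LimitOrderBook.laplace P (LimitOrderBook.firstPassage Wt 1) s)
          c 0 (LimitOrderBook.remainingProb P Q Wt 1)) := by
  have hσm : AEMeasurable (LimitOrderBook.firstPassage Q 0) P := hQ.aemeasurable_firstPassage 0
  have hεm : ∀ m, AEMeasurable (LimitOrderBook.firstPassage Wt m) P := fun m => hWt.aemeasurable_firstPassage m
  have hσpos : ∀ᵐ ω ∂P, 0 < LimitOrderBook.firstPassage Q 0 ω :=
    hQ.firstPassage_pos hlam (fun k => add_nonneg (hmu k) (hphi k)) hqBest
  -- Independence of whole paths passes to the rational passage times, which are measurable in the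
  -- path, and then to their almost sure versions.
  have hind : ∀ m, IndepFun (LimitOrderBook.firstPassage Q 0) (LimitOrderBook.firstPassage Wt m) P := fun m =>
    (hindep.comp (LimitOrderBook.measurable_rationalPassage 0) (LimitOrderBook.measurable_rationalPassage m)).congr
      (hQ.firstPassage_ae_eq 0).symm (hWt.firstPassage_ae_eq m).symm
  have hlap := fun m (hm : m ≤ q) => hWt.laplace_firstPassage hphiDeep hm
  have hne : ∀ m ≤ q, ∀ᵐ ω ∂P, LimitOrderBook.firstPassage Wt m ω ≠ LimitOrderBook.firstPassage Q 0 ω := fun m hm =>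
    hWt.ae_firstPassage_ne hphiDeep hσm hσpos hm (hind m)
  have hbrom := fun m (hm : m ≤ q) => fun c (hc : (0 : ℝ) < c) =>
    LimitOrderBook.isInverseLaplaceAt_laplace hσm (hεm m) hfin (hlap m hm).1 (hind m) (hne m hm) hc
  refine ⟨hlap, fun hq2 => ?_, fun m hm1 hmq => ?_, ?_⟩
  · have hprob : LimitOrderBook.remainingProb P Q Wt q =
        P.real {ω | LimitOrderBook.firstPassage Q 0 ω < LimitOrderBook.firstPassage Wt (q - 1) ω} := by
      rw [LimitOrderBook.remainingProb_eq hWt hphiDeep hfin hq2 le_rfl]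
      obtain ⟨T, -, -, hpass, -, -⟩ := hWt.exists_holdingTimes hphiDeep
      refine measureReal_congr ?_
      filter_upwards [hpass] with ω hp
      refine propext ⟨fun h => h.2, fun h => ⟨?_, h⟩⟩
      rw [hp q le_rfl]
      simp
    refine ⟨hprob, fun c hc hcq => ?_⟩
    have hq1 : q - 1 ≤ q := Nat.sub_le _ _
    have hint : Integrable (fun ω => Real.exp (c * (LimitOrderBook.firstPassage Wt (q - 1) ω).toReal)) P := by
      -- The exponential moment is the transform at s = -c; the only rate involved is the one at k =
      -- q, so c < φ_q suffices.
      have h1 := ((hlap (q - 1) hq1).2 (-c) fun k hk => by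
        have : k = q := by have := Finset.mem_Icc.1 hk; omega
        subst this
        simpa using hcq).1.norm
      refine h1.congr (ae_of_all _ fun ω => ?_)
      simp only [Complex.norm_exp]
      simp
    -- The roles are exchanged: ε_{q-1} is now the larger time.
    have h2 := (LimitOrderBook.isInverseLaplaceAt_laplace (hεm (q - 1)) hσm (hlap (q - 1) hq1).1 hfin
      (hind (q - 1)).symm ((hne (q - 1) hq1).mono fun ω h => h.symm) hc hint).2
    rw [hprob]
    simpa only [mul_right_comm] using h2
  · have hm0 : m - 1 ≤ q := by omega
    have hmono : ∀ᵐ ω ∂P, LimitOrderBook.firstPassage Wt m ω ≤ LimitOrderBook.firstPassage Wt (m - 1) ω := by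
      obtain ⟨T, -, -, hpass, -, -⟩ := hWt.exists_holdingTimes hphiDeep
      filter_upwards [hpass] with ω hp
      rw [hp m hmq.le, hp (m - 1) hm0]
      exact LimitOrderBook.sum_range_mono _ (by omega)
    have hprob : LimitOrderBook.remainingProb P Q Wt m =
        P.real {ω | LimitOrderBook.firstPassage Wt m ω < LimitOrderBook.firstPassage Q 0 ω} -
        P.real {ω | LimitOrderBook.firstPassage Wt (m - 1) ω < LimitOrderBook.firstPassage Q 0 ω} := by
      -- Ties being null, weak inequalities may be used; {ε_m ≤ σ} then splits along {ε_{m-1} ≤ σ},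
      -- which lies inside it up to a null set by `hmono`.
      rw [LimitOrderBook.remainingProb_eq hWt hphiDeep hfin hm1 hmq.le, ← LimitOrderBook.measureReal_le_eq_lt (hne m hmq.le),
        ← LimitOrderBook.measureReal_le_eq_lt (hne (m - 1) hm0), eq_sub_iff_add_eq,
        ← measureReal_inter_add_sdiff₀ (s := {ω | LimitOrderBook.firstPassage Wt m ω ≤ LimitOrderBook.firstPassage Q 0 ω})
          (nullMeasurableSet_le (hεm (m - 1)) hσm), add_comm]
      congr 1
      · refine measureReal_congr ?_
        filter_upwards [hmono] with ω h
        exact propext ⟨fun h' => ⟨h.trans h', h'⟩, fun h' => h'.2⟩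
      · refine congrArg _ (Set.ext fun ω => ?_)
        exact ⟨fun h => ⟨h.1, not_le.2 h.2⟩, fun h => ⟨h.1, not_le.1 h.2⟩⟩
    refine ⟨hprob, fun c hc hint => ?_⟩
    have h1 := hbrom m hmq.le c hc hint
    have h2 := hbrom (m - 1) hm0 c hc hint
    rw [hprob]
    simpa only [mul_sub] using h1.2.sub h2.2 h1.1 h2.1
  · have hprob := LimitOrderBook.remainingProb_one_eq hWt hphiDeep hfin hq
    rw [LimitOrderBook.measureReal_le_eq_lt (hne 1 hq)] at hprob
    refine ⟨hprob, fun c hc hint => ?_⟩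
    rw [hprob]
    exact (hbrom 1 hq c hc hint).2
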